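/- Let $M\in\{2,3\}$, let $\Omega\subset\mathbb R^M$ be a bounded domain with polygonal or polyhedral Lipschitz boundary, let $\gamma>0$, $\alpha\ge 0$ (with $\alpha=0$ if $M=2$; terms containing the vector product are absent for $M=2$), and let $0<T<\infty$. Write $(\cdot,\cdot)$ and $\|\cdot\|$ for the inner product and norm of $L^2(\Omega)$ (scalar, vector or matrix valued, with Euclidean/Frobenius pointwise norms). Let $\{\mathcal T_h\}$ be a family of shape-regular, quasi-uniform conforming triangulations of $\overline\Omega$ into triangles ($M=2$) or tetrahedra ($M=3$), with nodes $\mathcal N_h$. Let $Q_h$ be the space of continuous functions on $\overline\Omega$ that are affine on each element of $\mathcal T_h$, let $\boldsymbol U_h=Q_h^M$, let $i_{Q_h}$ be the nodal interpolation operator into $Q_h$, and put $(\boldsymbol u,\boldsymbol v)_h=\int_\Omega i_{Q_h}(\boldsymbol u\cdot\boldsymbol v)$ for functions $\boldsymbol u,\boldsymbol v$ given at the nodes. Let $\boldsymbol u_0\in H^1(\Omega)^M$ with $|\boldsymbol u_0|=1$ a.e. in $\Omega$, and let $\boldsymbol u_{0h}\in\boldsymbol U_h$ satisfy $|\boldsymbol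 u_{0h}(\boldsymbol a)|=1$ for all $\boldsymbol a\in\mathcal N_h$ and $\|\nabla\boldsymbol u_{0h}\|\le\|\nabla\boldsymbol u_0\|$. Let $(\boldsymbol u_h,q_h)\in C^\infty([0,\infty);\boldsymbol U_h)\times C^\infty([0,\infty);Q_h)$ satisfy $\boldsymbol u_h(0)=\boldsymbol u_{0h}$ and, for all $t\ge 0$ and all $(\bar{\boldsymbol u}_h,\bar q_h)\in\boldsymbol U_h\times Q_h$, $$(\partial_t\boldsymbol u_h,\bar{\boldsymbol u}_h)_h+\gamma(\nabla\boldsymbol u_h,\nabla\bar{\boldsymbol u}_h)+\gamma\bigl(q_h,i_{Q_h}(\boldsymbol u_h\cdot\bar{\boldsymbol u}_h)\bigr)+\alpha(\boldsymbol u_h\times\partial_t\boldsymbol u_h,\bar{\boldsymbol u}_h)_h=0,$$ $$\bigl(i_{Q_h}(\boldsymbol u_h\cdot\boldsymbol u_h),\bar q_h\bigr)=(1,\bar q_h).$$ Let $(H^1(\Omega)\cap L^\infty(\Omega))'$ be the dual of $H^1(\Omega)\cap L^\infty(\Omega)$ normed by $\|\nabla\varphi\|+\|\varphi\|_{L^\infty(\Omega)}$,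 and identify $q_h(t)$ with the functional $\varphi\mapsto(q_h(t),\varphi)$. Then $q_h\in L^2\bigl(0,T;(H^1(\Omega)\cap L^\infty(\Omega))'\bigr)$ and $$\|q_h\|_{L^2(0,T;(H^1(\Omega)\cap L^\infty(\Omega))')}\le C\,(1+\|\nabla\boldsymbol u_0\|)\,\|\nabla\boldsymbol u_0\|,$$ where the constant $C>0$ may depend on $\Omega$, $\gamma$, $\alpha$, $T$ and the family of triangulations, but not on $h$, $\boldsymbol u_0$, $\boldsymbol u_{0h}$, $\boldsymbol u_h$ or $q_h$. -/

import Mathlib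

open MeasureTheory Set Filter Topology
open scoped ENNReal ContDiff

namespace HarmonicFEM

noncomputable section

/-- The Euclidean space `ℝ^M`. -/
abbrev E (M : ℕ) := EuclideanSpace ℝ (Fin M)

/-- The `j`-th vector of the canonical basis of `ℝ^M`. -/
abbrev basisVec {M : ℕ} (j : Fin M) : E M := EuclideanSpace.single j 1

/-! ### Weak derivatives and the space `H¹ ∩ L^∞` -/

/-- `g` is the `j`-th partial derivative of `f` on `Ω` in the sense of distributions. -/
def HasWeakPartial {M : ℕ} {F : Type*} [NormedAddCommGroup F] [NormedSpace ℝ F]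
    (Ω : Set (E M)) (j : Fin M) (f g : E M → F) : Prop :=
  ∀ ψ : E M → ℝ, ContDiff ℝ ∞ ψ → HasCompactSupport ψ → tsupport ψ ⊆ Ω →
    ∫ x in Ω, fderiv ℝ ψ x (basisVec j) • f x = -∫ x in Ω, ψ x • g x

/-- `f ∈ H¹(Ω)`, with the distributional partial derivatives `∂_j f = Df j`. -/
structure IsH1 {M : ℕ} {F : Type*} [NormedAddCommGroup F] [NormedSpace ℝ F]
    (Ω : Set (E M)) (f : E M → F) (Df : Fin M → E M → F) : Prop where
  memLp : MemLp f 2 (volume.restrict Ω)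
  memLp_partial : ∀ j, MemLp (Df j) 2 (volume.restrict Ω)
  hasWeakPartial : ∀ j, HasWeakPartial Ω j f (Df j)

/-- The `L²(Ω)` norm `‖∇f‖` of a gradient with the partial derivatives `Df j`
(Euclidean, that is Frobenius, norm of the pointwise gradient). -/
def gradNorm {M : ℕ} {F : Type*} [NormedAddCommGroup F]
    (Ω : Set (E M)) (Df : Fin M → E M → F) : ℝ :=
  Real.sqrt (∫ x in Ω, ∑ j, ‖Df j x‖ ^ 2)

lemma integrable_smul_test {M : ℕ} {Ω : Set (E M)} {φ : E M → ℝ} (hφ : Continuous φ)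
    (hc : HasCompactSupport φ) {p : ℝ≥0∞} (hp : 1 ≤ p) {f : E M → ℝ}
    (hf : MemLp f p (volume.restrict Ω)) :
    Integrable (fun x => φ x • f x) (volume.restrict Ω) :=
  (hf.locallyIntegrable hp).integrable_smul_left_of_hasCompactSupport hφ hc

lemma memLp_coord {M : ℕ} {Ω : Set (E M)} (j : Fin M) (G : Lp (E M) 2 (volume.restrict Ω)) :
    MemLp (fun x => G x j) 2 (volume.restrict Ω) :=
  ContinuousLinearMap.comp_memLp (EuclideanSpace.proj j : E M →L[ℝ] ℝ) G

lemma continuous_partial {M : ℕ} (j : Fin M) {ψ : E M → ℝ} (h : ContDiff ℝ ∞ ψ) :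
    Continuous (fun x => fderiv ℝ ψ x (basisVec j)) :=
  (h.continuous_fderiv (by simp)).clm_apply continuous_const

lemma hasCompactSupport_partial {M : ℕ} (j : Fin M) {ψ : E M → ℝ} (h : HasCompactSupport ψ) :
    HasCompactSupport (fun x => fderiv ℝ ψ x (basisVec j)) :=
  h.fderiv_apply (𝕜 := ℝ) (basisVec j)

/-- The Banach space `H¹(Ω) ∩ L^∞(Ω)` of a bounded domain: a function `φ ∈ L^∞(Ω)` is paired with
its distributional gradient `∇φ ∈ L²(Ω)^M` (on a bounded `Ω`, `L^∞ ⊆ L²`).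
It carries the norm `‖φ‖_{L^∞(Ω)} + ‖∇φ‖_{L²(Ω)}`. -/
def H1Linf {M : ℕ} (Ω : Set (E M)) :
    Submodule ℝ (WithLp 1 (Lp ℝ ∞ (volume.restrict Ω) × Lp (E M) 2 (volume.restrict Ω))) where
  carrier := {p | ∀ j, HasWeakPartial Ω j p.fst (fun x => p.snd x j)}
  zero_mem' := by
    intro j ψ _ _ _
    have h1 : ∫ x in Ω, fderiv ℝ ψ x (basisVec j) • (0 : Lp ℝ ∞ (volume.restrict Ω)) x = 0 := by
      apply integral_eq_zero_of_ae
      filter_upwards [Lp.coeFn_zero ℝ ∞ (volume.restrict Ω)] with x hx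
      simp only [hx, Pi.zero_apply, smul_zero]
    have h2 : ∫ x in Ω, ψ x • (0 : Lp (E M) 2 (volume.restrict Ω)) x j = 0 := by
      apply integral_eq_zero_of_ae
      filter_upwards [Lp.coeFn_zero (E M) 2 (volume.restrict Ω)] with x hx
      simp only [hx, Pi.zero_apply, PiLp.zero_apply, smul_zero]
    simp only [WithLp.zero_fst, WithLp.zero_snd]
    rw [h1, h2, neg_zero]
  add_mem' := by
    intro p q hp hq j ψ h1 h2 h3
    have hpj := hp j ψ h1 h2 h3
    have hqj := hq j ψ h1 h2 h3
    have e1 : ∫ x in Ω, fderiv ℝ ψ x (basisVec j) • (p + q).fst x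
        = (∫ x in Ω, fderiv ℝ ψ x (basisVec j) • p.fst x)
          + ∫ x in Ω, fderiv ℝ ψ x (basisVec j) • q.fst x := by
      rw [← integral_add
        (integrable_smul_test (continuous_partial j h1) (hasCompactSupport_partial j h2)
          le_top (Lp.memLp p.fst))
        (integrable_smul_test (continuous_partial j h1) (hasCompactSupport_partial j h2)
          le_top (Lp.memLp q.fst))]
      apply integral_congr_ae
      filter_upwards [Lp.coeFn_add p.fst q.fst] with x hx
      rw [WithLp.add_fst, hx, Pi.add_apply, smul_add]
    have e2 : ∫ x in Ω, ψ x • (p + q).snd x j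
        = (∫ x in Ω, ψ x • p.snd x j) + ∫ x in Ω, ψ x • q.snd x j := by
      rw [← integral_add
        (integrable_smul_test h1.continuous h2 one_le_two (memLp_coord j p.snd))
        (integrable_smul_test h1.continuous h2 one_le_two (memLp_coord j q.snd))]
      apply integral_congr_ae
      filter_upwards [Lp.coeFn_add p.snd q.snd] with x hx
      rw [WithLp.add_snd, hx, Pi.add_apply, PiLp.add_apply, smul_add]
    rw [e1, e2, hpj, hqj, neg_add]
  smul_mem' := by
    intro c p hp j ψ h1 h2 h3
    have hpj := hp j ψ h1 h2 h3
    have e1 : ∫ x in Ω, fderiv ℝ ψ x (basisVec j) • (c • p).fst x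
        = c • ∫ x in Ω, fderiv ℝ ψ x (basisVec j) • p.fst x := by
      rw [← integral_smul]
      apply integral_congr_ae
      filter_upwards [Lp.coeFn_smul c p.fst] with x hx
      rw [WithLp.smul_fst, hx, Pi.smul_apply, smul_comm]
    have e2 : ∫ x in Ω, ψ x • (c • p).snd x j = c • ∫ x in Ω, ψ x • p.snd x j := by
      rw [← integral_smul]
      apply integral_congr_ae
      filter_upwards [Lp.coeFn_smul c p.snd] with x hx
      rw [WithLp.smul_snd, hx, Pi.smul_apply, PiLp.smul_apply, smul_comm]
    rw [e1, e2, hpj, smul_neg]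

/-! ### Domains and triangulations -/

/-- The boundary of `Ω` is Lipschitz continuous: near each boundary point `Ω` lies on one side of
the graph, over the hyperplane orthogonal to some unit vector `e`, of a Lipschitz function. -/
def HasLipschitzBoundary {M : ℕ} (Ω : Set (E M)) : Prop :=
  ∀ x₀ ∈ frontier Ω, ∃ e : E M, ‖e‖ = 1 ∧ ∃ (L : NNReal) (g : E M → ℝ), LipschitzWith L g ∧
    ∃ r > 0, ∀ y ∈ Metric.ball x₀ r,
      (y ∈ Ω ↔ inner ℝ e y < g (y - (inner ℝ e y) • e))

/-- A conforming triangulation of `closure Ω` by finitely many closed `M`-simplices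
(triangles for `M = 2`, tetrahedra for `M = 3`). -/
structure Triangulation {M : ℕ} (Ω : Set (E M)) where
  complex : Geometry.SimplicialComplex ℝ (E M)
  finite_faces : complex.faces.Finite
  face_subset_elem : ∀ s ∈ complex.faces, ∃ t ∈ complex.faces, t.card = M + 1 ∧ s ⊆ t
  cover : (⋃ s ∈ {s | s ∈ complex.faces ∧ s.card = M + 1}, convexHull ℝ (s : Set (E M)))
    = closure Ω

namespace Triangulation

variable {M : ℕ} {Ω : Set (E M)}

/-- The elements `K` of the mesh, each given by its set of vertices. -/
def elems (𝒯 : Triangulation Ω) : Set (Finset (E M)) :=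
  {s | s ∈ 𝒯.complex.faces ∧ s.card = M + 1}

/-- The set of nodes of the mesh. -/
def nodes (𝒯 : Triangulation Ω) : Set (E M) := 𝒯.complex.vertices

/-- The mesh size `h = max_K h_K`. -/
def meshSize (𝒯 : Triangulation Ω) : ℝ :=
  sSup ((fun s : Finset (E M) => Metric.diam (convexHull ℝ (s : Set (E M)))) '' 𝒯.elems)

end Triangulation

/-- The diameter `ρ_K` of the largest ball contained in `K`. -/
def inDiam {M : ℕ} (K : Set (E M)) : ℝ :=
  sSup {d : ℝ | 0 ≤ d ∧ ∃ x, Metric.closedBall x (d / 2) ⊆ K}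

/-- Shape regularity of a family of triangulations: `h_K ≤ σ ρ_K`, with the same `σ` for all
elements `K` of all the meshes. -/
def ShapeRegular {M : ℕ} {Ω : Set (E M)} {ι : Type*} (𝒯 : ι → Triangulation Ω) : Prop :=
  ∃ σ : ℝ, ∀ i, ∀ s ∈ (𝒯 i).elems,
    Metric.diam (convexHull ℝ (s : Set (E M))) ≤ σ * inDiam (convexHull ℝ (s : Set (E M)))

/-- Quasi-uniformity of a family of triangulations: `h ≤ τ h_K`, with the same `τ` for all
elements `K` of all the meshes. -/
def QuasiUniform {M : ℕ} {Ω : Set (E M)} {ι : Type*} (𝒯 : ι → Triangulation Ω) : Prop :=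
  ∃ τ : ℝ, ∀ i, ∀ s ∈ (𝒯 i).elems,
    (𝒯 i).meshSize ≤ τ * Metric.diam (convexHull ℝ (s : Set (E M)))

/-! ### Finite element spaces -/

/-- The space of continuous, piecewise affine functions on the mesh, with values in `F`:
`X_h` for `F = ℝ`, and its `M`-fold power for `F = ℝ^M`. Such a function is
a function on `closure Ω`; the values of a representative outside `closure Ω` are irrelevant. -/
def feSpace {M : ℕ} {Ω : Set (E M)} (𝒯 : Triangulation Ω) (F : Type*) [NormedAddCommGroup F]
    [NormedSpace ℝ F] : Submodule ℝ (E M → F) where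
  carrier := {v | ContinuousOn v (closure Ω) ∧
    ∀ s ∈ 𝒯.elems, ∃ A : E M →ᵃ[ℝ] F, EqOn v A (convexHull ℝ (s : Set (E M)))}
  zero_mem' := ⟨continuousOn_const, fun _ _ => ⟨0, fun _ _ => rfl⟩⟩
  add_mem' := by
    rintro v w ⟨hv, hv'⟩ ⟨hw, hw'⟩
    refine ⟨hv.add hw, fun s hs => ?_⟩
    obtain ⟨A, hA⟩ := hv' s hs
    obtain ⟨B, hB⟩ := hw' s hs
    exact ⟨A + B, fun x hx => by simp [hA hx, hB hx]⟩
  smul_mem' := by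
    rintro c v ⟨hv, hv'⟩
    refine ⟨hv.const_smul c, fun s hs => ?_⟩
    obtain ⟨A, hA⟩ := hv' s hs
    exact ⟨c • A, fun x hx => by simp [hA hx]⟩

lemma exists_affine_of_values {M : ℕ} (s : Finset (E M))
    (hs : AffineIndependent ℝ ((↑) : s → E M)) (hc : s.card = M + 1) (w : E M → ℝ) :
    ∃ A : E M →ᵃ[ℝ] ℝ, ∀ a ∈ s, A a = w a := by
  have htop : affineSpan ℝ (range ((↑) : s → E M)) = ⊤ := by
    rw [hs.affineSpan_eq_top_iff_card_eq_finrank_add_one]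
    simp [hc]
  let b : AffineBasis s ℝ (E M) := ⟨(↑), hs, htop⟩
  refine ⟨∑ a : s, w a • b.coord a, fun a ha => ?_⟩
  have hsum : ∀ (t : Finset s) (x : E M),
      (∑ a ∈ t, w a • b.coord a) x = ∑ a ∈ t, w a * b.coord a x := by
    intro t x
    induction t using Finset.cons_induction with
    | empty => simp
    | cons c t hct ih =>
      rw [Finset.sum_cons, Finset.sum_cons, AffineMap.coe_add, Pi.add_apply, ih]; simp
  have hb : ∀ c : s, b.coord c a = if c = ⟨a, ha⟩ then 1 else 0 := fun c =>
    b.coord_apply c ⟨a, ha⟩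
  rw [hsum]
  simp [hb]

/-- Every nodal function has an interpolant in `X_h`. -/
theorem exists_interpolant {M : ℕ} {Ω : Set (E M)} (𝒯 : Triangulation Ω) (w : E M → ℝ) :
    ∃ p ∈ feSpace 𝒯 ℝ, ∀ a ∈ 𝒯.nodes, p a = w a := by
  classical
  have hA : ∀ s : 𝒯.elems, ∃ A : E M →ᵃ[ℝ] ℝ, ∀ a ∈ s.1, A a = w a := fun s =>
    exists_affine_of_values s.1 (𝒯.complex.indep s.2.1) s.2.2 w
  choose A hA using hA
  let p : E M → ℝ := fun x =>
    if h : ∃ s : 𝒯.elems, x ∈ convexHull ℝ (s.1 : Set (E M)) then A h.choose x else 0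
  have hp : ∀ s : 𝒯.elems, EqOn p (A s) (convexHull ℝ (s.1 : Set (E M))) := by
    intro s x hx
    have h : ∃ s : 𝒯.elems, x ∈ convexHull ℝ (s.1 : Set (E M)) := ⟨s, hx⟩
    have hpx : p x = A h.choose x := dif_pos h
    rw [hpx]
    have hmem := 𝒯.complex.inter_subset_convexHull h.choose.2.1 s.2.1 ⟨h.choose_spec, hx⟩
    have hEq : EqOn (A h.choose) (A s) (affineSpan ℝ (h.choose.1 ∩ s.1 : Set (E M))) :=
      AffineMap.eqOn_affineSpan (fun a ha => by
        rw [hA h.choose a ha.1, hA s a ha.2])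
    exact hEq (convexHull_subset_affineSpan _ hmem)
  have hfin : 𝒯.elems.Finite := 𝒯.finite_faces.subset fun s hs => hs.1
  have : Finite 𝒯.elems := hfin
  refine ⟨p, ⟨?_, fun s hs => ⟨A ⟨s, hs⟩, hp ⟨s, hs⟩⟩⟩, ?_⟩
  · have hcov : closure Ω = ⋃ s : 𝒯.elems, convexHull ℝ (s.1 : Set (E M)) := by
      rw [← 𝒯.cover, iUnion_subtype]; rfl
    rw [hcov]
    refine (locallyFinite_of_finite _).continuousOn_iUnion (fun s => ?_) (fun s => ?_)
    · exact (s.1.finite_toSet.isCompact_convexHull ℝ).isClosed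
    · exact ((A s).continuous_of_finiteDimensional.continuousOn).congr (hp s)
  · intro a ha
    obtain ⟨t, ht, htc, hat⟩ := 𝒯.face_subset_elem {a} ha
    have hat' : a ∈ t := hat (Finset.mem_singleton_self a)
    rw [hp ⟨t, ht, htc⟩ (subset_convexHull ℝ _ hat'), hA ⟨t, ht, htc⟩ a hat']

/-- The nodal interpolation operator into `Q_h = X_h` (its value is unique on `closure Ω`). -/
def nodalInterp {M : ℕ} {Ω : Set (E M)} (𝒯 : Triangulation Ω) (w : E M → ℝ) : E M → ℝ :=
  (exists_interpolant 𝒯 w).choose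

/-- The mass-lumped inner product `(u, v)_h = ∫_Ω i_h(u · v)`. -/
def lumpedInner {M : ℕ} {Ω : Set (E M)} (𝒯 : Triangulation Ω) (u v : E M → E M) : ℝ :=
  ∫ x in Ω, nodalInterp 𝒯 (fun y => inner ℝ (u y) (v y)) x

/-- The partial derivatives of a finite element function. The classical derivative exists in the
interior of each element, hence almost everywhere, and there it is the weak derivative. -/
def fePartial {M : ℕ} {F : Type*} [NormedAddCommGroup F] [NormedSpace ℝ F]
    (v : E M → F) (j : Fin M) : E M → F :=
  fun x => fderiv ℝ v x (basisVec j)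

/-- `(∇u, ∇v)` for finite element functions. -/
def gradInner {M : ℕ} (Ω : Set (E M)) (u v : E M → E M) : ℝ :=
  ∫ x in Ω, ∑ j, inner ℝ (fePartial u j x) (fePartial v j x)

/-- The vector product of `ℝ³`; it does not occur in dimension two, where it is set to zero. -/
def vecCross : {M : ℕ} → E M → E M → E M
  | 3, a, b => WithLp.toLp 2 (crossProduct (WithLp.ofLp a) (WithLp.ofLp b))
  | _, _, _ => 0

/-- The time derivative at time `t ∈ [0, ∞)`, one-sided at `t = 0`. -/
def timeDeriv {M : ℕ} (u : ℝ → E M → E M) (t : ℝ) : E M → E M :=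
  fun x => derivWithin (fun s => u s x) (Ici 0) t

/-- `v ∈ C^∞([0,∞); X)` for `X` the finite element space with values in `F`. As this space is
finite dimensional, smoothness in time is smoothness of the values `v(·, x)`. -/
def IsSmoothInTime {M : ℕ} {Ω : Set (E M)} (𝒯 : Triangulation Ω) {F : Type*}
    [NormedAddCommGroup F] [NormedSpace ℝ F] (v : ℝ → E M → F) : Prop :=
  (∀ t ∈ Ici (0 : ℝ), v t ∈ feSpace 𝒯 F) ∧
    ∀ x ∈ closure Ω, ContDiffOn ℝ ∞ (fun t => v t x) (Ici 0)

/-- `(u, q)` solves the semi-discrete saddle-point scheme with initial datum `u0h`. -/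
structure IsFEMSolution {M : ℕ} {Ω : Set (E M)} (𝒯 : Triangulation Ω) (γ α : ℝ)
    (u0h : E M → E M) (u : ℝ → E M → E M) (q : ℝ → E M → ℝ) : Prop where
  smooth_u : IsSmoothInTime 𝒯 u
  smooth_q : IsSmoothInTime 𝒯 q
  momentum : ∀ t ∈ Ici (0 : ℝ), ∀ v ∈ feSpace 𝒯 (E M),
    lumpedInner 𝒯 (timeDeriv u t) v + γ * gradInner Ω (u t) v
      + γ * (∫ x in Ω, q t x * nodalInterp 𝒯 (fun y => inner ℝ (u t y) (v y)) x)
      + α * lumpedInner 𝒯 (fun y => vecCross (u t y) (timeDeriv u t y)) v = 0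
  sphere : ∀ t ∈ Ici (0 : ℝ), ∀ r ∈ feSpace 𝒯 ℝ,
    ∫ x in Ω, nodalInterp 𝒯 (fun y => inner ℝ (u t y) (u t y)) x * r x = ∫ x in Ω, 1 * r x
  initial : EqOn (u 0) u0h (closure Ω)

/-- The assumptions on the data: `u0 ∈ H¹(Ω)^M` with weak partial derivatives `Du0`, `|u0| = 1`
a.e., and `u0h` is a finite element function of unit length at the nodes with
`‖∇u0h‖ ≤ ‖∇u0‖`. -/
structure IsInitialData {M : ℕ} {Ω : Set (E M)} (𝒯 : Triangulation Ω)
    (u0 : E M → E M) (Du0 : Fin M → E M → E M) (u0h : E M → E M) : Prop where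
  isH1 : IsH1 Ω u0 Du0
  unit : ∀ᵐ x ∂(volume.restrict Ω), ‖u0 x‖ = 1
  mem : u0h ∈ feSpace 𝒯 (E M)
  unit_nodes : ∀ a ∈ 𝒯.nodes, ‖u0h a‖ = 1
  grad_le : gradNorm Ω (fePartial u0h) ≤ gradNorm Ω Du0

end

end HarmonicFEM

open HarmonicFEM

/-!
The second equation of the scheme says that the nodal interpolant of `|u|²` is `1`, so `u` has unit
length at every node and is there orthogonal to its time derivative. Two consequences follow.

* *Energy.* Testing the momentum equation with the time derivative of `u` removes the multiplier and
  the vector product, hence `‖∇u(t)‖ ≤ ‖∇u(0)‖` (`IsFEMSolution.gradInner_le`).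
* *Formula for the multiplier.* For a finite element function `p`, testing with the interpolant of
  `p u` leaves `(q, p) = -(∇u, ∇ i_h(p u))`, since `u · (p u) = p` at the nodes
  (`IsFEMSolution.abs_integral_mul_le`). On a simplex with vertices `a`, `b`, ... and barycentric
  coordinates `λ_a`, the integrand on the right is
  `∑ k_ab p_b (u_a · u_b) = -(1/2) ∑ k_ab p_b |u_a - u_b|²` with `k_ab = ∇λ_a · ∇λ_b`, because
  the row sums of `k` vanish and `u_a · u_b = 1 - |u_a - u_b|² / 2`. So
  `|(q, p)| ≤ C max |p| ‖∇u‖²`, without any derivative of `p`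
  (`abs_sum_inner_partial_le`).

For a general `φ ∈ L^∞(Ω)`, `(q, φ) = (q, p)` with `p` the `L²(Ω)` projection of `φ`, and what is
needed is `max |p| ≤ C ‖φ‖` on a shape-regular, quasi-uniform mesh (`exists_projection_bound`).
To bound `p` at a node `z`, the projection is tested with the interpolant of `w p`, where
`w(x) = (1 + δ|x - z| / h)^(-M-1)` is integrable and varies little over an element. The element mass
matrices are coercive, also with the weight (`weighted_le_integral_mul`), so that
`∑_K |K| ∑_{a ∈ K} w_a p_a² ≤ C ‖φ‖² ∫ w ≤ C ‖φ‖² h^M`, while the left side is at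
least `|K| p(z)² ≥ c h^M p(z)²` for an element `K` containing `z`.

Altogether `|(q(t), φ)| ≤ C ‖∇u0‖² ‖φ‖_{L^∞}` for every `t ≥ 0`, which is stronger than the
claimed bound in the dual norm of `H¹(Ω) ∩ L^∞(Ω)`. The Lipschitz boundary enters only through the
fact that the boundary of `Ω` is a null set, so that integrals over `Ω` are sums over the elements.
-/

namespace HarmonicFEM

/-! ### Affine functions on a simplex -/

section Simplex

variable {M : ℕ}

lemma abs_affine_le {s : Finset (E M)} {p : E M →ᵃ[ℝ] ℝ} {B : ℝ} (h : ∀ a ∈ s, |p a| ≤ B)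
    {x : E M} (hx : x ∈ convexHull ℝ (s : Set (E M))) : |p x| ≤ B := by
  have hc : Convex ℝ (p ⁻¹' Icc (-B) B) := (convex_Icc (-B) B).affine_preimage p
  have := convexHull_min (fun a ha => abs_le.1 (h a ha)) hc hx
  exact abs_le.2 this

lemma continuous_affine {F : Type*} [NormedAddCommGroup F] [NormedSpace ℝ F]
    (p : E M →ᵃ[ℝ] F) : Continuous p :=
  p.continuous_of_finiteDimensional

lemma isCompact_simplex (s : Finset (E M)) : IsCompact (convexHull ℝ (s : Set (E M))) :=
  s.finite_toSet.isCompact_convexHull ℝ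

/-- The volume of a simplex, as a real number. -/
noncomputable def simplexVol (s : Finset (E M)) : ℝ :=
  (volume : Measure (E M)).real (convexHull ℝ (s : Set (E M)))

lemma simplexVol_nonneg (s : Finset (E M)) : 0 ≤ simplexVol s := measureReal_nonneg

lemma integrableOn_simplex (s : Finset (E M)) {f : E M → ℝ} (hf : Continuous f) :
    IntegrableOn f (convexHull ℝ (s : Set (E M))) :=
  hf.continuousOn.integrableOn_compact (isCompact_simplex s)

/-- The constant in the lower bound of `∫_K p²` by the vertex values of an affine function `p`. -/
noncomputable def massConst (M : ℕ) : ℝ := (1 / 4) ^ M / 4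

lemma massConst_pos (M : ℕ) : 0 < massConst M := by unfold massConst; positivity

lemma massConst_le_one (M : ℕ) : massConst M ≤ 1 := by
  have : (1 / 4 : ℝ) ^ M ≤ 1 := pow_le_one₀ (by norm_num) (by norm_num)
  unfold massConst
  linarith

/-- If `|p|` is largest at the vertex `a`, then `|p| ≥ |p a| / 2` on the copy of the simplex
shrunk towards `a` by the factor `1/4`. -/
lemma massConst_mul_le_integral_sq_of_max (s : Finset (E M)) (p : E M →ᵃ[ℝ] ℝ) {a : E M}
    (ha : a ∈ s) (hmax : ∀ b ∈ s, |p b| ≤ |p a|) :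
    massConst M * simplexVol s * p a ^ 2 ≤ ∫ x in convexHull ℝ (s : Set (E M)), p x ^ 2 := by
  set K := convexHull ℝ (s : Set (E M)) with hK
  have haK : a ∈ K := subset_convexHull ℝ _ ha
  set H := AffineMap.homothety a (1 / 4 : ℝ) with hH
  have hsub : H '' K ⊆ K := by
    rintro _ ⟨y, hy, rfl⟩
    have : H y = AffineMap.lineMap a y (1 / 4 : ℝ) := by
      simp [hH, AffineMap.homothety_eq_lineMap]
    rw [this]
    exact (convex_convexHull ℝ _).lineMap_mem haK hy ⟨by norm_num, by norm_num⟩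
  have hcomp : IsCompact (H '' K) := (isCompact_simplex s).image (continuous_affine H)
  have hvol : (volume : Measure (E M)).real (H '' K) = (1 / 4) ^ M * simplexVol s := by
    rw [Measure.real, Measure.addHaar_image_homothety, ENNReal.toReal_mul,
      ENNReal.toReal_ofReal (abs_nonneg _), abs_of_nonneg (by positivity)]
    simp [simplexVol, Measure.real, hK]
  have hlow : ∀ x ∈ H '' K, p a ^ 2 / 4 ≤ p x ^ 2 := by
    rintro _ ⟨y, hy, rfl⟩
    have h1 : p (H y) = p a + (p y - p a) / 4 := by
      have : H y = AffineMap.lineMap a y (1 / 4 : ℝ) := by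
        simp [hH, AffineMap.homothety_eq_lineMap]
      rw [this, AffineMap.apply_lineMap, AffineMap.lineMap_apply]
      simp; ring
    have h2 : |p y| ≤ |p a| := abs_affine_le hmax hy
    have h3 : |p a| / 2 ≤ |p (H y)| := by
      rw [h1]
      rcases abs_cases (p a) with h | h <;> rcases abs_cases (p y) with h' | h' <;>
        rcases abs_cases (p a + (p y - p a) / 4) with h'' | h'' <;> linarith
    have h4 := pow_le_pow_left₀ (by positivity) h3 2
    rw [sq_abs, div_pow, sq_abs] at h4
    linarith
  calc massConst M * simplexVol s * p a ^ 2
      = ∫ _ in H '' K, p a ^ 2 / 4 := by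
        rw [setIntegral_const, hvol, massConst, smul_eq_mul]; ring
    _ ≤ ∫ x in H '' K, p x ^ 2 :=
        setIntegral_mono_on (integrableOn_const hcomp.measure_ne_top)
          (((continuous_affine p).pow 2).continuousOn.integrableOn_compact hcomp)
          hcomp.measurableSet hlow
    _ ≤ ∫ x in K, p x ^ 2 :=
        setIntegral_mono_set (integrableOn_simplex s ((continuous_affine p).pow 2))
          (Eventually.of_forall fun x => sq_nonneg _) hsub.eventuallyLE

lemma massConst_mul_le_integral_sq (s : Finset (E M)) (p : E M →ᵃ[ℝ] ℝ) {a : E M}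
    (ha : a ∈ s) :
    massConst M * simplexVol s * p a ^ 2 ≤ ∫ x in convexHull ℝ (s : Set (E M)), p x ^ 2 := by
  obtain ⟨b, hb, hmax⟩ := s.exists_max_image (fun b => |p b|) ⟨a, ha⟩
  refine le_trans ?_ (massConst_mul_le_integral_sq_of_max s p hb hmax)
  exact mul_le_mul_of_nonneg_left (sq_le_sq.2 (hmax a ha))
    (mul_nonneg (massConst_pos M).le (simplexVol_nonneg s))

/-- Coercivity of the element mass matrix in a weighted norm. The weights `w a` vary so little
over the simplex that the affine function `r` with vertex values `w a * p a` is a small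
perturbation of `w₀ * p`, with `w₀` one of the weights. -/
lemma weighted_le_integral_mul (s : Finset (E M)) (p r : E M →ᵃ[ℝ] ℝ) (w : E M → ℝ)
    (hw : ∀ a ∈ s, 0 < w a) (hslow : ∀ a ∈ s, ∀ b ∈ s, w a ≤ (1 + massConst M / 2) * w b)
    (hr : ∀ a ∈ s, r a = w a * p a) :
    massConst M / 4 * simplexVol s * ∑ a ∈ s, w a * p a ^ 2
      ≤ s.card * ∫ x in convexHull ℝ (s : Set (E M)), p x * r x := by
  rcases s.eq_empty_or_nonempty with rfl | hne
  · simp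
  set K := convexHull ℝ (s : Set (E M)) with hK
  obtain ⟨b, hb, hmax⟩ := s.exists_max_image (fun b => |p b|) hne
  have hκ := massConst_pos M
  have hκ1 := massConst_le_one M
  set κ := massConst M with hκdef
  have hwb := hw b hb
  -- the perturbation `r - w b • p`
  set e : E M →ᵃ[ℝ] ℝ := r - w b • p with he
  have hex : ∀ x, e x = r x - w b * p x := fun x => by simp [he]
  have hebound : ∀ x ∈ K, |e x| ≤ κ / 2 * w b * |p b| := by
    intro x hx
    refine abs_affine_le (fun a ha => ?_) hx
    have h1 : e a = (w a - w b) * p a := by rw [hex, hr a ha]; ring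
    have h2 : |w a - w b| ≤ κ / 2 * w b := by
      have h3 := hslow a ha b hb
      have h4 := hslow b hb a ha
      rw [abs_le]
      constructor
      · nlinarith [hw a ha]
      · linarith
    rw [h1, abs_mul]
    exact mul_le_mul h2 (hmax a ha) (abs_nonneg _) (by positivity)
  have hV := simplexVol_nonneg s
  have hint : ∫ x in K, (w b * p x ^ 2 - κ / 2 * w b * p b ^ 2) ≤ ∫ x in K, p x * r x := by
    refine setIntegral_mono_on ?_ ?_ (isCompact_simplex s).measurableSet ?_
    · exact integrableOn_simplex s
        ((continuous_const.mul ((continuous_affine p).pow 2)).sub continuous_const)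
    · exact integrableOn_simplex s ((continuous_affine p).mul (continuous_affine r))
    · intro x hx
      have h1 := hebound x hx
      have h2 : |p x| ≤ |p b| := abs_affine_le hmax hx
      have h3 : |p x * e x| ≤ κ / 2 * w b * p b ^ 2 := by
        rw [abs_mul, ← sq_abs (p b)]
        calc |p x| * |e x| ≤ |p b| * (κ / 2 * w b * |p b|) :=
              mul_le_mul h2 h1 (abs_nonneg _) (abs_nonneg _)
          _ = _ := by ring
      have h4 : p x * r x = w b * p x ^ 2 + p x * e x := by rw [hex]; ring
      rw [h4]
      linarith [neg_abs_le (p x * e x)]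
  have hcalc : ∫ x in K, (w b * p x ^ 2 - κ / 2 * w b * p b ^ 2)
      = w b * (∫ x in K, p x ^ 2) - simplexVol s * (κ / 2 * w b * p b ^ 2) := by
    rw [integral_sub, integral_const_mul, setIntegral_const]
    · rfl
    · exact integrableOn_simplex s (continuous_const.mul ((continuous_affine p).pow 2))
    · exact integrableOn_simplex s continuous_const
  have hlow := massConst_mul_le_integral_sq s p hb
  have hsum : ∑ a ∈ s, w a * p a ^ 2 ≤ s.card * (2 * w b * p b ^ 2) := by
    rw [← nsmul_eq_mul]
    refine Finset.sum_le_card_nsmul _ _ _ fun a ha => ?_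
    refine mul_le_mul ?_ (sq_le_sq.2 (hmax a ha)) (sq_nonneg _) (by positivity)
    nlinarith [hslow a ha b hb]
  have hmain : κ / 2 * simplexVol s * (w b * p b ^ 2) ≤ ∫ x in K, p x * r x := by
    rw [hcalc] at hint
    nlinarith [mul_le_mul_of_nonneg_left hlow hwb.le]
  calc κ / 4 * simplexVol s * ∑ a ∈ s, w a * p a ^ 2
      ≤ κ / 4 * simplexVol s * (s.card * (2 * w b * p b ^ 2)) := by gcongr
    _ = s.card * (κ / 2 * simplexVol s * (w b * p b ^ 2)) := by ring
    _ ≤ _ := by gcongr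

/-- On a set containing a ball of radius `δ`, an affine function with values in `[0, 1]`
has partial derivatives at most `1 / δ`. -/
lemma abs_partial_le (p : E M →ᵃ[ℝ] ℝ) {K : Set (E M)} (hp : ∀ x ∈ K, p x ∈ Icc (0 : ℝ) 1)
    {x : E M} {δ : ℝ} (hδ : 0 < δ) (hball : Metric.closedBall x δ ⊆ K) (j : Fin M) :
    |p.linear (basisVec j)| ≤ 1 / δ := by
  have h0 := hp x (hball (Metric.mem_closedBall_self hδ.le))
  have h1 := hp (δ • basisVec j + x) (hball (by
    rw [Metric.mem_closedBall, dist_eq_norm, add_sub_cancel_right, norm_smul]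
    simp [abs_of_pos hδ]))
  have h2 : p (δ • basisVec j + x) = δ * p.linear (basisVec j) + p x := by
    rw [← vadd_eq_add, AffineMap.map_vadd]; simp
  rw [h2] at h1
  rw [le_div_iff₀ hδ, ← abs_of_pos hδ, ← abs_mul, abs_le, mul_comm]
  constructor <;> linarith [h0.1, h0.2, h1.1, h1.2]

lemma affine_sub_eq_sum {F : Type*} [NormedAddCommGroup F] [NormedSpace ℝ F]
    (p : E M →ᵃ[ℝ] F) (x y : E M) :
    p x - p y = ∑ j, (x - y) j • p.linear (basisVec j) := by
  have h : x - y = ∑ j, (x - y) j • (basisVec j : E M) := by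
    conv_lhs => rw [← (EuclideanSpace.basisFun (Fin M) ℝ).sum_repr (x - y)]
    simp
  rw [← vsub_eq_sub (p x), ← AffineMap.linearMap_vsub, vsub_eq_sub, h, map_sum]
  simp only [map_smul]
  rw [← h]

lemma sq_norm_affine_sub_le (p : E M →ᵃ[ℝ] E M) (x y : E M) :
    ‖p x - p y‖ ^ 2 ≤ ‖x - y‖ ^ 2 * ∑ j, ‖p.linear (basisVec j)‖ ^ 2 := by
  rw [affine_sub_eq_sum, EuclideanSpace.norm_sq_eq (x - y)]
  refine le_trans (pow_le_pow_left₀ (norm_nonneg _) (norm_sum_le _ _) 2) ?_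
  simp only [norm_smul]
  exact Finset.sum_mul_sq_le_sq_mul_sq _ _ _

/-- Let `u` be affine on a simplex with unit vectors as vertex values, and let `v` have the vertex
values `c a • u a`. With the stiffness coefficients `k a b = ∇λ_a · ∇λ_b`, whose row sums vanish,
`∇u : ∇v = ∑ k a b * c b * ⟪u a, u b⟫ = -(1/2) ∑ k a b * c b * ‖u a - u b‖²`. Hence no derivative
of the coefficient `c` enters the bound. -/
lemma abs_sum_inner_partial_le (s : Finset (E M)) (hs : AffineIndependent ℝ ((↑) : s → E M))
    (hc : s.card = M + 1) {x : E M} {ρ h : ℝ} (hρ : 0 < ρ) (hh : 0 < h)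
    (hball : Metric.closedBall x (ρ * h) ⊆ convexHull ℝ (s : Set (E M)))
    (hdiam : ∀ a ∈ s, ∀ b ∈ s, ‖a - b‖ ≤ h)
    (u v : E M →ᵃ[ℝ] E M) (c : E M → ℝ) {B : ℝ} (hB : ∀ a ∈ s, |c a| ≤ B)
    (hu : ∀ a ∈ s, ‖u a‖ = 1) (hv : ∀ a ∈ s, v a = c a • u a) :
    |∑ j, inner ℝ (u.linear (basisVec j)) (v.linear (basisVec j))|
      ≤ ((M + 1) ^ 2 * (M / ρ ^ 2)) * B * ∑ j, ‖u.linear (basisVec j)‖ ^ 2 := by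
  classical
  have hl : ∀ a : E M, ∃ l : E M →ᵃ[ℝ] ℝ, ∀ b ∈ s, l b = if b = a then 1 else 0 := fun a =>
    exists_affine_of_values s hs hc _
  choose l hl using hl
  have htop : affineSpan ℝ (s : Set (E M)) = ⊤ := by
    have := hs.affineSpan_eq_top_iff_card_eq_finrank_add_one.2 (by simp [hc])
    simpa using this
  have hext : ∀ {F : Type} [NormedAddCommGroup F] [NormedSpace ℝ F] (p q : E M →ᵃ[ℝ] F),
      (∀ a ∈ s, p a = q a) → p = q := by
    intro F _ _ p q hpq
    ext y
    exact AffineMap.eqOn_affineSpan (s := (s : Set (E M))) hpq (htop ▸ AffineSubspace.mem_top ℝ _ y)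
  -- expansion of an affine map in barycentric coordinates
  have hsum : ∀ {F : Type} [NormedAddCommGroup F] [NormedSpace ℝ F] (c : E M → F)
      (t : Finset (E M)) (y : E M),
      (∑ a ∈ t, (LinearMap.toSpanSingleton ℝ F (c a)).toAffineMap.comp (l a)) y
        = ∑ a ∈ t, l a y • c a := by
    intro F _ _ c t y
    induction t using Finset.cons_induction with
    | empty => simp
    | cons a t ha ih =>
      rw [Finset.sum_cons, Finset.sum_cons, AffineMap.coe_add, Pi.add_apply, ih]; simp
  have hexp : ∀ {F : Type} [NormedAddCommGroup F] [NormedSpace ℝ F] (p : E M →ᵃ[ℝ] F)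
      (y : E M), p y = ∑ a ∈ s, l a y • p a := by
    intro F _ _ p y
    rw [← hsum p s y]
    refine congrArg (fun f : E M →ᵃ[ℝ] F => f y) (hext _ _ fun b hb => ?_)
    rw [hsum, Finset.sum_congr rfl fun a _ => by rw [hl a b hb]]
    simp [hb]
  have hlin : ∀ {F : Type} [NormedAddCommGroup F] [NormedSpace ℝ F] (p : E M →ᵃ[ℝ] F) (e : E M),
      p.linear e = p e - p 0 := by
    intro F _ _ p e
    have := p.linearMap_vsub e 0
    simpa using this
  have hexpl : ∀ {F : Type} [NormedAddCommGroup F] [NormedSpace ℝ F] (p : E M →ᵃ[ℝ] F)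
      (e : E M), p.linear e = ∑ a ∈ s, (l a).linear e • p a := by
    intro F _ _ p e
    rw [hlin, hexp p e, hexp p 0, ← Finset.sum_sub_distrib]
    exact Finset.sum_congr rfl fun a _ => by rw [hlin, sub_smul]
  have hone : ∀ e : E M, ∑ a ∈ s, (l a).linear e = 0 := by
    intro e
    simpa using (hexpl (AffineMap.const ℝ (E M) (1 : ℝ)) e).symm
  have hl01 : ∀ a, ∀ y ∈ convexHull ℝ (s : Set (E M)), l a y ∈ Icc (0 : ℝ) 1 := by
    intro a y hy
    refine convexHull_min (fun b hb => ?_) ((convex_Icc (0 : ℝ) 1).affine_preimage (l a)) hy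
    show l a b ∈ Icc (0 : ℝ) 1
    rw [hl a b hb]
    split_ifs <;> simp
  have hδ : 0 < ρ * h := by positivity
  set k : E M → E M → ℝ := fun a b =>
    ∑ j, (l a).linear (basisVec j) * (l b).linear (basisVec j) with hk
  have hkb : ∀ a b, |k a b| ≤ M / (ρ * h) ^ 2 := by
    intro a b
    refine (Finset.abs_sum_le_sum_abs _ _).trans ?_
    have : ∀ j ∈ (Finset.univ : Finset (Fin M)),
        |(l a).linear (basisVec j) * (l b).linear (basisVec j)| ≤ (1 / (ρ * h)) * (1 / (ρ * h)) := by
      intro j _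
      rw [abs_mul]
      exact mul_le_mul (abs_partial_le _ (hl01 a) hδ hball j) (abs_partial_le _ (hl01 b) hδ hball j)
        (abs_nonneg _) (by positivity)
    refine (Finset.sum_le_card_nsmul _ _ _ this).trans (le_of_eq ?_)
    simp; ring
  have hrow : ∀ b, ∑ a ∈ s, k a b = 0 := by
    intro b
    simp only [hk]
    rw [Finset.sum_comm]
    refine Finset.sum_eq_zero fun j _ => ?_
    rw [← Finset.sum_mul, hone, zero_mul]
  have hG : 0 ≤ ∑ j, ‖u.linear (basisVec j)‖ ^ 2 := Finset.sum_nonneg fun _ _ => sq_nonneg _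
  set G := ∑ j, ‖u.linear (basisVec j)‖ ^ 2 with hGdef
  have hinner : ∀ a ∈ s, ∀ b ∈ s, inner ℝ (u a) (u b) = 1 - ‖u a - u b‖ ^ 2 / 2 := by
    intro a ha b hb
    rw [norm_sub_sq_real, hu a ha, hu b hb]; ring
  have hid : ∑ j, inner ℝ (u.linear (basisVec j)) (v.linear (basisVec j))
      = -∑ b ∈ s, ∑ a ∈ s, k a b * c b * (‖u a - u b‖ ^ 2 / 2) := by
    calc ∑ j, inner ℝ (u.linear (basisVec j)) (v.linear (basisVec j))
        = ∑ j, ∑ b ∈ s, ∑ a ∈ s, (l a).linear (basisVec j) * (l b).linear (basisVec j)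
            * c b * inner ℝ (u a) (u b) := by
          refine Finset.sum_congr rfl fun j _ => ?_
          rw [hexpl u, hexpl v, inner_sum]
          refine Finset.sum_congr rfl fun b hb => ?_
          rw [sum_inner]
          refine Finset.sum_congr rfl fun a _ => ?_
          rw [hv b hb, real_inner_smul_left, real_inner_smul_right, real_inner_smul_right]
          ring
      _ = ∑ b ∈ s, ∑ a ∈ s, k a b * c b * inner ℝ (u a) (u b) := by
          rw [Finset.sum_comm]
          refine Finset.sum_congr rfl fun b _ => ?_
          rw [Finset.sum_comm]
          refine Finset.sum_congr rfl fun a _ => ?_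
          simp only [hk, Finset.sum_mul]
      _ = ∑ b ∈ s, (c b * ∑ a ∈ s, k a b
            - ∑ a ∈ s, k a b * c b * (‖u a - u b‖ ^ 2 / 2)) := by
          refine Finset.sum_congr rfl fun b hb => ?_
          rw [Finset.mul_sum, ← Finset.sum_sub_distrib]
          refine Finset.sum_congr rfl fun a ha => ?_
          rw [hinner a ha b hb]; ring
      _ = _ := by simp [hrow]
  have hterm : ∀ b ∈ s, ∀ a ∈ s, |k a b * c b * (‖u a - u b‖ ^ 2 / 2)|
      ≤ M / ρ ^ 2 * B * G := by
    intro b hb a ha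
    have h1 : ‖u a - u b‖ ^ 2 ≤ h ^ 2 * G :=
      (sq_norm_affine_sub_le u a b).trans (mul_le_mul_of_nonneg_right
        (pow_le_pow_left₀ (norm_nonneg _) (hdiam a ha b hb) 2) hG)
    have hB0 : 0 ≤ B := (abs_nonneg _).trans (hB b hb)
    rw [abs_mul, abs_mul, abs_of_nonneg (by positivity : 0 ≤ ‖u a - u b‖ ^ 2 / 2)]
    calc |k a b| * |c b| * (‖u a - u b‖ ^ 2 / 2)
        ≤ M / (ρ * h) ^ 2 * B * (h ^ 2 * G) := by
          have h2 : ‖u a - u b‖ ^ 2 / 2 ≤ h ^ 2 * G := by nlinarith [sq_nonneg ‖u a - u b‖]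
          exact mul_le_mul (mul_le_mul (hkb a b) (hB b hb) (abs_nonneg _) (by positivity)) h2
            (by positivity) (by positivity)
      _ = M / ρ ^ 2 * B * G := by field_simp
  rw [hid, abs_neg]
  calc |∑ b ∈ s, ∑ a ∈ s, k a b * c b * (‖u a - u b‖ ^ 2 / 2)|
      ≤ ∑ b ∈ s, ∑ a ∈ s, |k a b * c b * (‖u a - u b‖ ^ 2 / 2)| :=
        (Finset.abs_sum_le_sum_abs _ _).trans
          (Finset.sum_le_sum fun b _ => Finset.abs_sum_le_sum_abs _ _)
    _ ≤ ∑ b ∈ s, ∑ a ∈ s, M / ρ ^ 2 * B * G :=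
        Finset.sum_le_sum fun b hb => Finset.sum_le_sum fun a ha => hterm b hb a ha
    _ = _ := by
        simp only [Finset.sum_const, hc, nsmul_eq_mul]; push_cast; ring

end Simplex

/-! ### Decomposition of the domain into elements -/

/-- A domain with Lipschitz boundary lies locally on one side of its boundary. -/
lemma HasLipschitzBoundary.interior_closure_subset {M : ℕ} {Ω : Set (E M)}
    (hlip : HasLipschitzBoundary Ω) (hΩ : IsOpen Ω) : interior (closure Ω) ⊆ Ω := by
  intro x hx
  by_contra hxΩ
  have hfr : x ∈ frontier Ω := ⟨interior_subset hx, by rwa [hΩ.interior_eq]⟩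
  obtain ⟨e, he, L, g, hg, r, hr, hiff⟩ := hlip x hfr
  -- the height of a point above the graph
  set f : E M → ℝ := fun y => inner ℝ e y - g (y - (inner ℝ e y) • e) with hf
  have hfc : Continuous f := by
    have := hg.continuous
    fun_prop
  have hfx : 0 ≤ f x := by
    by_contra h
    exact hxΩ ((hiff x (Metric.mem_ball_self hr)).2 (by simp only [hf] at h; linarith))
  have hft : ∀ t : ℝ, f (x + t • e) = f x + t := by
    intro t
    have h1 : (inner ℝ e (x + t • e) : ℝ) = inner ℝ e x + t := by
      rw [inner_add_right, inner_smul_right, real_inner_self_eq_norm_sq, he]; ring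
    simp only [hf, h1, add_smul]
    rw [show x + t • e - (inner ℝ e x • e + t • e) = x - inner ℝ e x • e by abel]
    ring
  have hlim : Tendsto (fun t : ℝ => x + t • e) (𝓝[>] 0) (𝓝 x) := by
    have : Continuous fun t : ℝ => x + t • e := by fun_prop
    simpa using (this.tendsto 0).mono_left nhdsWithin_le_nhds
  have hev : ∀ᶠ t in 𝓝[>] (0 : ℝ), x + t • e ∈ interior (closure Ω) ∩ Metric.ball x r :=
    hlim ((isOpen_interior.inter Metric.isOpen_ball).mem_nhds ⟨hx, Metric.mem_ball_self hr⟩)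
  obtain ⟨t, ht, ht0⟩ := (hev.and self_mem_nhdsWithin).exists
  have hopen : IsOpen (f ⁻¹' Ioi 0 ∩ Metric.ball x r) :=
    (isOpen_Ioi.preimage hfc).inter Metric.isOpen_ball
  have hmem : x + t • e ∈ f ⁻¹' Ioi 0 ∩ Metric.ball x r := by
    refine ⟨?_, ht.2⟩
    show 0 < f (x + t • e)
    rw [hft]
    have : 0 < t := ht0
    linarith
  obtain ⟨y, ⟨hy1, hy2⟩, hyΩ⟩ :=
    mem_closure_iff.1 (interior_subset ht.1) _ hopen hmem
  have h1 := (hiff y hy2).1 hyΩ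
  have h2 : 0 < f y := hy1
  simp only [hf] at h2
  linarith

namespace Triangulation

variable {M : ℕ} {Ω : Set (E M)} (𝒯 : Triangulation Ω)

lemma finite_elems : 𝒯.elems.Finite := 𝒯.finite_faces.subset fun _ hs => hs.1

lemma finite_nodes : 𝒯.nodes.Finite :=
  𝒯.finite_faces.preimage Finset.singleton_injective.injOn

/-- The elements of the mesh, as a finset. -/
noncomputable def elemFinset : Finset (Finset (E M)) := 𝒯.finite_elems.toFinset

/-- The nodes of the mesh, as a finset. -/
noncomputable def nodeFinset : Finset (E M) := 𝒯.finite_nodes.toFinset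

variable {𝒯}

@[simp] lemma mem_elemFinset {s : Finset (E M)} : s ∈ 𝒯.elemFinset ↔ s ∈ 𝒯.elems := by
  simp [elemFinset]

@[simp] lemma mem_nodeFinset {a : E M} : a ∈ 𝒯.nodeFinset ↔ a ∈ 𝒯.nodes := by
  simp [nodeFinset]

lemma mem_nodes_of_mem {s : Finset (E M)} (hs : s ∈ 𝒯.elems) {a : E M} (ha : a ∈ s) :
    a ∈ 𝒯.nodes :=
  (𝒯.complex.isRelLowerSet_faces hs.1).2 (Finset.singleton_subset_iff.2 ha)
    (Finset.singleton_nonempty a)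

lemma exists_elem_of_mem_nodes {a : E M} (ha : a ∈ 𝒯.nodes) : ∃ s ∈ 𝒯.elems, a ∈ s := by
  obtain ⟨t, ht, htc, hat⟩ := 𝒯.face_subset_elem {a} ha
  exact ⟨t, ⟨ht, htc⟩, hat (Finset.mem_singleton_self a)⟩

lemma closure_eq_iUnion :
    closure Ω = ⋃ s : 𝒯.elemFinset, convexHull ℝ ((s : Finset (E M)) : Set (E M)) := by
  rw [← 𝒯.cover, iUnion_subtype]
  simp only [mem_elemFinset]; rfl

lemma elem_subset_closure {s : Finset (E M)} (hs : s ∈ 𝒯.elems) :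
    convexHull ℝ (s : Set (E M)) ⊆ closure Ω := by
  rw [closure_eq_iUnion (𝒯 := 𝒯)]
  exact subset_iUnion (fun s : 𝒯.elemFinset => convexHull ℝ ((s : Finset (E M)) : Set (E M)))
    ⟨s, mem_elemFinset.2 hs⟩

lemma exists_elem_of_mem_closure {x : E M} (hx : x ∈ closure Ω) :
    ∃ s ∈ 𝒯.elems, x ∈ convexHull ℝ (s : Set (E M)) := by
  rw [closure_eq_iUnion (𝒯 := 𝒯)] at hx
  obtain ⟨s, hs⟩ := mem_iUnion.1 hx
  exact ⟨s, mem_elemFinset.1 s.2, hs⟩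

lemma mem_closure_of_mem_nodes {a : E M} (ha : a ∈ 𝒯.nodes) : a ∈ closure Ω := by
  obtain ⟨s, hs, has⟩ := exists_elem_of_mem_nodes ha
  exact elem_subset_closure hs (subset_convexHull ℝ _ has)

lemma isCompact_closure (𝒯 : Triangulation Ω) : IsCompact (closure Ω) := by
  rw [closure_eq_iUnion (𝒯 := 𝒯)]
  exact isCompact_iUnion fun s => isCompact_simplex s.1

lemma volume_biUnion_frontier_elem (𝒯 : Triangulation Ω) :
    volume (⋃ s : 𝒯.elemFinset, frontier (convexHull ℝ ((s : Finset (E M)) : Set (E M)))) = 0 :=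
  measure_iUnion_null fun _ => (convex_convexHull ℝ _).addHaar_frontier volume

lemma volume_frontier (𝒯 : Triangulation Ω) (hlip : HasLipschitzBoundary Ω) (hΩ : IsOpen Ω) :
    volume (frontier Ω) = 0 := by
  refine measure_mono_null (fun x hx => ?_) 𝒯.volume_biUnion_frontier_elem
  obtain ⟨s, hs, hxs⟩ := exists_elem_of_mem_closure (𝒯 := 𝒯) hx.1
  refine mem_iUnion.2 ⟨⟨s, mem_elemFinset.2 hs⟩, subset_closure hxs, fun hint => ?_⟩
  have h1 := hlip.interior_closure_subset hΩ (interior_mono (elem_subset_closure hs) hint)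
  exact hx.2 (by rwa [hΩ.interior_eq])

lemma restrict_eq_restrict_closure (𝒯 : Triangulation Ω) (hlip : HasLipschitzBoundary Ω) (hΩ : IsOpen Ω) :
    (volume : Measure (E M)).restrict Ω = volume.restrict (closure Ω) := by
  refine Measure.restrict_congr_set (subset_closure.eventuallyLE.antisymm ?_)
  rw [ae_le_set]
  rw [← hΩ.frontier_eq]
  exact 𝒯.volume_frontier hlip hΩ

lemma ae_mem_interior_elem (𝒯 : Triangulation Ω) :
    ∀ᵐ x ∂(volume.restrict Ω), ∃ s ∈ 𝒯.elems, x ∈ interior (convexHull ℝ (s : Set (E M))) := by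
  have h1 : ∀ᵐ x ∂(volume : Measure (E M)), x ∉
      ⋃ s : 𝒯.elemFinset, frontier (convexHull ℝ ((s : Finset (E M)) : Set (E M))) :=
    measure_eq_zero_iff_ae_notMem.1 𝒯.volume_biUnion_frontier_elem
  refine ae_restrict_of_ae_restrict_of_subset (subset_closure (s := Ω)) ?_
  filter_upwards [ae_restrict_of_ae h1, ae_restrict_mem isClosed_closure.measurableSet] with x hx hxc
  obtain ⟨s, hs, hxs⟩ := exists_elem_of_mem_closure (𝒯 := 𝒯) hxc
  refine ⟨s, hs, ?_⟩
  by_contra hint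
  exact hx (mem_iUnion.2 ⟨⟨s, mem_elemFinset.2 hs⟩, subset_closure hxs, hint⟩)

/-- Distinct elements of a conforming mesh meet in the convex hull of at most `M` points. -/
lemma aedisjoint_elem {s t : Finset (E M)} (hs : s ∈ 𝒯.elems) (ht : t ∈ 𝒯.elems) (hst : s ≠ t) :
    AEDisjoint volume (convexHull ℝ (s : Set (E M))) (convexHull ℝ (t : Set (E M))) := by
  classical
  have hcard : (s ∩ t).card < M + 1 := by
    rw [← hs.2]
    refine Finset.card_lt_card (Finset.inter_subset_left.ssubset_of_ne fun h => hst ?_)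
    exact Finset.eq_of_subset_of_card_le (Finset.inter_eq_left.1 h) (by rw [hs.2, ht.2])
  have hne : affineSpan ℝ ((s ∩ t : Finset (E M)) : Set (E M)) ≠ ⊤ := by
    intro htop
    have hind : AffineIndependent ℝ ((↑) : (s ∩ t : Finset (E M)) → E M) :=
      (𝒯.complex.indep hs.1).mono (by exact_mod_cast Finset.inter_subset_left)
    have := hind.affineSpan_eq_top_iff_card_eq_finrank_add_one.1
      (by rw [Subtype.range_coe_subtype]; exact htop)
    simp at this
    omega
  refine measure_mono_null ?_ (Measure.addHaar_affineSubspace volume _ hne)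
  refine (𝒯.complex.inter_subset_convexHull hs.1 ht.1).trans ?_
  rw [← Finset.coe_inter]
  exact convexHull_subset_affineSpan _

lemma setIntegral_eq_sum (𝒯 : Triangulation Ω) (hlip : HasLipschitzBoundary Ω) (hΩ : IsOpen Ω) {f : E M → ℝ}
    (hf : IntegrableOn f (closure Ω)) :
    ∫ x in Ω, f x = ∑ s ∈ 𝒯.elemFinset, ∫ x in convexHull ℝ (s : Set (E M)), f x := by
  have hpair : Pairwise (Function.onFun (AEDisjoint volume)
      fun s : 𝒯.elemFinset => convexHull ℝ ((s : Finset (E M)) : Set (E M))) := fun s t hst =>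
    aedisjoint_elem (mem_elemFinset.1 s.2) (mem_elemFinset.1 t.2) (fun h => hst (Subtype.ext h))
  rw [closure_eq_iUnion (𝒯 := 𝒯)] at hf
  have h := integral_iUnion_ae
    (fun s : 𝒯.elemFinset => (isCompact_simplex s.1).measurableSet.nullMeasurableSet) hpair hf
  rw [𝒯.restrict_eq_restrict_closure hlip hΩ, closure_eq_iUnion (𝒯 := 𝒯), h, tsum_fintype]
  exact Finset.sum_coe_sort 𝒯.elemFinset (fun s => ∫ x in convexHull ℝ (s : Set (E M)), f x)

end Triangulation

/-! ### Finite element functions and nodal values -/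

section FiniteElements

variable {M : ℕ} {Ω : Set (E M)} {𝒯 : Triangulation Ω} {F : Type*} [NormedAddCommGroup F]
  [NormedSpace ℝ F]

lemma eqOn_of_mem_feSpace {v w : E M → F} (hv : v ∈ feSpace 𝒯 F) (hw : w ∈ feSpace 𝒯 F)
    (h : ∀ a ∈ 𝒯.nodes, v a = w a) : EqOn v w (closure Ω) := by
  intro x hx
  obtain ⟨s, hs, hxs⟩ := Triangulation.exists_elem_of_mem_closure (𝒯 := 𝒯) hx
  obtain ⟨A, hA⟩ := hv.2 s hs
  obtain ⟨B, hB⟩ := hw.2 s hs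
  rw [hA hxs, hB hxs]
  refine AffineMap.eqOn_affineSpan (fun a ha => ?_) (convexHull_subset_affineSpan _ hxs)
  rw [← hA (subset_convexHull ℝ _ ha), ← hB (subset_convexHull ℝ _ ha)]
  exact h a (Triangulation.mem_nodes_of_mem hs ha)

lemma nodalInterp_mem (𝒯 : Triangulation Ω) (w : E M → ℝ) : nodalInterp 𝒯 w ∈ feSpace 𝒯 ℝ :=
  (exists_interpolant 𝒯 w).choose_spec.1

lemma nodalInterp_apply (w : E M → ℝ) {a : E M} (ha : a ∈ 𝒯.nodes) : nodalInterp 𝒯 w a = w a :=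
  (exists_interpolant 𝒯 w).choose_spec.2 a ha

open Classical in
/-- The nodal basis function of the node `a`. -/
noncomputable def hat (𝒯 : Triangulation Ω) (a : E M) : E M → ℝ :=
  nodalInterp 𝒯 (fun b => if b = a then 1 else 0)

lemma hat_mem (𝒯 : Triangulation Ω) (a : E M) : hat 𝒯 a ∈ feSpace 𝒯 ℝ := nodalInterp_mem _ _

lemma smul_const_mem_feSpace {p : E M → ℝ} (hp : p ∈ feSpace 𝒯 ℝ) (c : F) :
    (fun x => p x • c) ∈ feSpace 𝒯 F := by
  refine ⟨hp.1.smul continuousOn_const, fun s hs => ?_⟩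
  obtain ⟨A, hA⟩ := hp.2 s hs
  exact ⟨(LinearMap.toSpanSingleton ℝ F c).toAffineMap.comp A, fun x hx => by simp [hA hx]⟩

/-- The finite element function with the nodal values `c`, for values in any normed space. -/
noncomputable def feInterp (𝒯 : Triangulation Ω) (c : E M → F) : E M → F :=
  fun x => ∑ a ∈ 𝒯.nodeFinset, hat 𝒯 a x • c a

lemma feInterp_mem (𝒯 : Triangulation Ω) (c : E M → F) : feInterp 𝒯 c ∈ feSpace 𝒯 F := by
  have : feInterp 𝒯 c = ∑ a ∈ 𝒯.nodeFinset, fun x => hat 𝒯 a x • c a := by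
    ext x; simp [feInterp]
  rw [this]
  exact Submodule.sum_mem _ fun a _ => smul_const_mem_feSpace (hat_mem 𝒯 a) (c a)

lemma feInterp_apply (c : E M → F) {a : E M} (ha : a ∈ 𝒯.nodes) : feInterp 𝒯 c a = c a := by
  classical
  have h : ∀ b ∈ 𝒯.nodeFinset, hat 𝒯 b a • c b = if a = b then c a else 0 := by
    intro b _
    rw [hat, nodalInterp_apply _ ha]
    split_ifs with h
    · rw [h, one_smul]
    · rw [zero_smul]
  rw [feInterp, Finset.sum_congr rfl h]
  simp [ha]

lemma eqOn_feInterp {v : E M → F} (hv : v ∈ feSpace 𝒯 F) {c : E M → F}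
    (h : ∀ a ∈ 𝒯.nodes, v a = c a) : EqOn v (feInterp 𝒯 c) (closure Ω) :=
  eqOn_of_mem_feSpace hv (feInterp_mem 𝒯 c) fun a ha => by rw [h a ha, feInterp_apply c ha]

lemma eqOn_nodalInterp {v : E M → ℝ} (hv : v ∈ feSpace 𝒯 ℝ) {c : E M → ℝ}
    (h : ∀ a ∈ 𝒯.nodes, v a = c a) : EqOn v (nodalInterp 𝒯 c) (closure Ω) :=
  eqOn_of_mem_feSpace hv (nodalInterp_mem 𝒯 c) fun a ha => by rw [h a ha, nodalInterp_apply c ha]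

lemma integrableOn_mul_of_mem_feSpace {p r : E M → ℝ} (hp : p ∈ feSpace 𝒯 ℝ)
    (hr : r ∈ feSpace 𝒯 ℝ) : IntegrableOn (fun x => p x * r x) (closure Ω) :=
  (hp.1.mul hr.1).integrableOn_compact 𝒯.isCompact_closure

lemma abs_le_of_mem_feSpace {p : E M → ℝ} (hp : p ∈ feSpace 𝒯 ℝ) {s : Finset (E M)}
    (hs : s ∈ 𝒯.elems) {B : ℝ} (h : ∀ a ∈ s, |p a| ≤ B) {x : E M}
    (hx : x ∈ convexHull ℝ (s : Set (E M))) : |p x| ≤ B := by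
  obtain ⟨A, hA⟩ := hp.2 s hs
  rw [hA hx]
  exact abs_affine_le (fun a ha => by rw [← hA (subset_convexHull ℝ _ ha)]; exact h a ha) hx

end FiniteElements

/-! ### Regular meshes -/

/-- The elements of the mesh have diameter at most `h` and contain a ball of radius `ρ * h`. -/
structure Triangulation.IsRegular {M : ℕ} {Ω : Set (E M)} (𝒯 : Triangulation Ω) (ρ h : ℝ) :
    Prop where
  h_pos : 0 < h
  exists_ball : ∀ s ∈ 𝒯.elems, ∃ x, Metric.closedBall x (ρ * h) ⊆ convexHull ℝ (s : Set (E M))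
  norm_sub_le : ∀ s ∈ 𝒯.elems, ∀ x ∈ convexHull ℝ (s : Set (E M)),
    ∀ y ∈ convexHull ℝ (s : Set (E M)), ‖x - y‖ ≤ h

lemma exists_forall_isRegular {M : ℕ} (hM : 0 < M) {Ω : Set (E M)} {ι : Type*}
    (𝒯 : ι → Triangulation Ω) (hshape : ShapeRegular 𝒯) (hquasi : QuasiUniform 𝒯) :
    ∃ ρ : ℝ, 0 < ρ ∧ ∀ i, ∃ h, (𝒯 i).IsRegular ρ h := by
  obtain ⟨σ, hσ⟩ := hshape
  obtain ⟨τ, hτ⟩ := hquasi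
  set σ' := max σ 1
  set τ' := max τ 1
  have hσ' : 0 < σ' := lt_max_of_lt_right one_pos
  have hτ' : 0 < τ' := lt_max_of_lt_right one_pos
  refine ⟨1 / (4 * (σ' * τ')), by positivity, fun i => ?_⟩
  rcases (𝒯 i).elems.eq_empty_or_nonempty with hemp | ⟨s₀, hs₀⟩
  · exact ⟨1, one_pos, fun s hs => by simp [hemp] at hs, fun s hs => by simp [hemp] at hs⟩
  have hbdd : BddAbove ((fun s : Finset (E M) =>
      Metric.diam (convexHull ℝ (s : Set (E M)))) '' (𝒯 i).elems) :=
    ((𝒯 i).finite_elems.image _).bddAbove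
  have hle : ∀ s ∈ (𝒯 i).elems,
      Metric.diam (convexHull ℝ (s : Set (E M))) ≤ (𝒯 i).meshSize := fun s hs =>
    le_csSup hbdd (mem_image_of_mem _ hs)
  have hdist : ∀ s ∈ (𝒯 i).elems, ∀ x ∈ convexHull ℝ (s : Set (E M)),
      ∀ y ∈ convexHull ℝ (s : Set (E M)), ‖x - y‖ ≤ (𝒯 i).meshSize := fun s hs x hx y hy => by
    rw [← dist_eq_norm]
    exact (Metric.dist_le_diam_of_mem (isCompact_simplex s).isBounded hx hy).trans (hle s hs)
  have hh : 0 < (𝒯 i).meshSize := by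
    obtain ⟨a, ha, b, hb, hab⟩ := Finset.one_lt_card.1 (by rw [hs₀.2]; omega : 1 < s₀.card)
    exact (norm_pos_iff.2 (sub_ne_zero.2 hab)).trans_le
      (hdist s₀ hs₀ a (subset_convexHull ℝ _ ha) b (subset_convexHull ℝ _ hb))
  refine ⟨(𝒯 i).meshSize, hh, fun s hs => ?_, hdist⟩
  set K := convexHull ℝ (s : Set (E M)) with hK
  have hin0 : 0 ≤ inDiam K := Real.sSup_nonneg fun d hd => hd.1
  have hin : (𝒯 i).meshSize ≤ σ' * τ' * inDiam K :=
    calc (𝒯 i).meshSize ≤ τ * Metric.diam K := hτ i s hs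
      _ ≤ τ' * Metric.diam K := by gcongr; exact le_max_left _ _
      _ ≤ τ' * (σ' * inDiam K) := by
          gcongr
          exact (hσ i s hs).trans (by gcongr; exact le_max_left _ _)
      _ = σ' * τ' * inDiam K := by ring
  have hlt : (𝒯 i).meshSize / (2 * (σ' * τ')) < inDiam K := by
    rw [div_lt_iff₀ (by positivity)]
    linarith
  have hne : {d : ℝ | 0 ≤ d ∧ ∃ x, Metric.closedBall x (d / 2) ⊆ K}.Nonempty := by
    by_contra hemp
    rw [not_nonempty_iff_eq_empty] at hemp
    have h0 : inDiam K = 0 := by rw [inDiam, hemp, Real.sSup_empty]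
    rw [h0] at hlt
    exact absurd hlt (not_lt.2 (by positivity))
  obtain ⟨d, ⟨_, x, hx⟩, hd⟩ := exists_lt_of_lt_csSup hne hlt
  refine ⟨x, (Metric.closedBall_subset_closedBall ?_).trans hx⟩
  have : 1 / (4 * (σ' * τ')) * (𝒯 i).meshSize = (𝒯 i).meshSize / (2 * (σ' * τ')) / 2 := by
    field_simp; ring
  rw [this]
  linarith

section Regular

variable {M : ℕ} {Ω : Set (E M)} {𝒯 : Triangulation Ω} {ρ h : ℝ}

/-- The volume of the unit ball. -/
noncomputable def unitBallVol (M : ℕ) : ℝ := (volume : Measure (E M)).real (Metric.ball 0 1)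

lemma unitBallVol_pos (M : ℕ) : 0 < unitBallVol M :=
  ENNReal.toReal_pos (Metric.measure_ball_pos volume 0 one_pos).ne' measure_ball_lt_top.ne

lemma Triangulation.IsRegular.le_simplexVol (hreg : 𝒯.IsRegular ρ h) (hρ : 0 < ρ)
    {s : Finset (E M)} (hs : s ∈ 𝒯.elems) : (ρ * h) ^ M * unitBallVol M ≤ simplexVol s := by
  have hh := hreg.h_pos
  obtain ⟨x, hx⟩ := hreg.exists_ball s hs
  have h1 : (volume : Measure (E M)).real (Metric.closedBall x (ρ * h))
      = (ρ * h) ^ M * unitBallVol M := by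
    rw [Measure.real, Measure.addHaar_closedBall volume x (by positivity), ENNReal.toReal_mul,
      ENNReal.toReal_ofReal (by positivity)]
    simp [unitBallVol, Measure.real]
  rw [← h1]
  exact measureReal_mono hx (isCompact_simplex s).measure_ne_top

lemma Triangulation.IsRegular.simplexVol_pos (hreg : 𝒯.IsRegular ρ h) (hρ : 0 < ρ)
    {s : Finset (E M)} (hs : s ∈ 𝒯.elems) : 0 < simplexVol s :=
  lt_of_lt_of_le (mul_pos (pow_pos (mul_pos hρ hreg.h_pos) M) (unitBallVol_pos M))
    (hreg.le_simplexVol hρ hs)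

lemma eq_zero_of_integral_mul_self_eq_zero (hlip : HasLipschitzBoundary Ω) (hΩ : IsOpen Ω)
    (hreg : 𝒯.IsRegular ρ h) (hρ : 0 < ρ) {p : E M → ℝ} (hp : p ∈ feSpace 𝒯 ℝ)
    (h0 : ∫ x in Ω, p x * p x = 0) : ∀ a ∈ 𝒯.nodes, p a = 0 := by
  intro a ha
  obtain ⟨s, hs, has⟩ := Triangulation.exists_elem_of_mem_nodes ha
  rw [𝒯.setIntegral_eq_sum hlip hΩ (integrableOn_mul_of_mem_feSpace hp hp),
    Finset.sum_eq_zero_iff_of_nonneg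
      (fun t _ => integral_nonneg fun x => mul_self_nonneg (p x))] at h0
  have h1 := h0 s (Triangulation.mem_elemFinset.2 hs)
  obtain ⟨A, hA⟩ := hp.2 s hs
  have h2 : ∫ x in convexHull ℝ (s : Set (E M)), A x ^ 2 = 0 := by
    rw [← h1]
    refine setIntegral_congr_fun (isCompact_simplex s).measurableSet fun x hx => ?_
    simp only [hA hx, sq]
  have h3 := massConst_mul_le_integral_sq s A has
  rw [h2] at h3
  have h4 := mul_pos (massConst_pos M) (hreg.simplexVol_pos hρ hs)
  have h5 : A a ^ 2 ≤ 0 := by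
    by_contra hc
    have := mul_pos h4 (not_le.1 hc)
    linarith
  rw [hA (subset_convexHull ℝ _ has)]
  exact pow_eq_zero_iff two_ne_zero |>.1 (le_antisymm h5 (sq_nonneg _))

/-- The finite element space contains an `L²(Ω)` projection of every `φ`. -/
lemma exists_projection (hlip : HasLipschitzBoundary Ω) (hΩ : IsOpen Ω)
    (hreg : 𝒯.IsRegular ρ h) (hρ : 0 < ρ) (φ : E M → ℝ)
    (hφ : ∀ r ∈ feSpace 𝒯 ℝ, IntegrableOn (fun x => φ x * r x) Ω) :
    ∃ p ∈ feSpace 𝒯 ℝ, ∀ r ∈ feSpace 𝒯 ℝ, ∫ x in Ω, p x * r x = ∫ x in Ω, φ x * r x := by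
  classical
  let ext : (𝒯.nodeFinset → ℝ) → E M → ℝ := fun c a =>
    if ha : a ∈ 𝒯.nodeFinset then c ⟨a, ha⟩ else 0
  have hint : ∀ v ∈ feSpace 𝒯 ℝ, ∀ w ∈ feSpace 𝒯 ℝ, IntegrableOn (fun x => v x * w x) Ω :=
    fun v hv w hw => (integrableOn_mul_of_mem_feSpace hv hw).mono_set subset_closure
  let m : Matrix 𝒯.nodeFinset 𝒯.nodeFinset ℝ := Matrix.of fun b a =>
    ∫ x in Ω, hat 𝒯 a x * hat 𝒯 b x
  have hm : ∀ c b, (m.mulVecLin c) b = ∫ x in Ω, feInterp 𝒯 (ext c) x * hat 𝒯 b x := by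
    intro c b
    have h1 : ∀ x, feInterp 𝒯 (ext c) x * hat 𝒯 b x
        = ∑ a : 𝒯.nodeFinset, hat 𝒯 a x * hat 𝒯 b x * c a := by
      intro x
      rw [feInterp, ← Finset.sum_coe_sort, Finset.sum_mul]
      refine Finset.sum_congr rfl fun a _ => ?_
      simp only [ext, smul_eq_mul, dif_pos a.2]
      ring
    simp only [h1]
    rw [integral_finsetSum Finset.univ
      (fun (a : 𝒯.nodeFinset) _ => (hint _ (hat_mem 𝒯 a) _ (hat_mem 𝒯 b)).mul_const (c a))]
    simp only [integral_mul_const]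
    rfl
  -- testing with the nodal basis is testing with all finite element functions
  have hexp : ∀ (f : E M → ℝ), (∀ r ∈ feSpace 𝒯 ℝ, IntegrableOn (fun x => f x * r x) Ω) →
      ∀ r ∈ feSpace 𝒯 ℝ,
        ∫ x in Ω, f x * r x = ∑ b : 𝒯.nodeFinset, (∫ x in Ω, f x * hat 𝒯 b x) * r b := by
    intro f hf r hr
    have h1 : ∫ x in Ω, f x * r x = ∫ x in Ω, ∑ b : 𝒯.nodeFinset, f x * hat 𝒯 b x * r b := by
      refine setIntegral_congr_fun hΩ.measurableSet fun x hx => ?_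
      show f x * r x = _
      rw [eqOn_feInterp hr (fun _ _ => rfl) (subset_closure hx), feInterp, ← Finset.sum_coe_sort,
        Finset.mul_sum]
      refine Finset.sum_congr rfl fun a _ => ?_
      simp only [smul_eq_mul]
      ring
    rw [h1, integral_finsetSum Finset.univ
      (fun (b : 𝒯.nodeFinset) _ => (hf _ (hat_mem 𝒯 b)).mul_const (r b))]
    simp only [integral_mul_const]
  have hinj : Function.Injective m.mulVecLin := by
    rw [injective_iff_map_eq_zero]
    intro c hc
    have hmem := feInterp_mem 𝒯 (ext c)
    have h1 : ∫ x in Ω, feInterp 𝒯 (ext c) x * feInterp 𝒯 (ext c) x = 0 := by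
      rw [hexp _ (fun r hr => hint _ hmem r hr) _ hmem]
      refine Finset.sum_eq_zero fun b _ => ?_
      rw [← hm, hc, Pi.zero_apply, zero_mul]
    ext a
    have h2 := eq_zero_of_integral_mul_self_eq_zero hlip hΩ hreg hρ hmem h1 a
      (Triangulation.mem_nodeFinset.1 a.2)
    rw [feInterp_apply _ (Triangulation.mem_nodeFinset.1 a.2)] at h2
    simp only [ext, dif_pos a.2] at h2
    exact h2
  obtain ⟨c, hc⟩ := LinearMap.injective_iff_surjective.1 hinj
    (fun b => ∫ x in Ω, φ x * hat 𝒯 b x)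
  refine ⟨feInterp 𝒯 (ext c), feInterp_mem 𝒯 _, fun r hr => ?_⟩
  rw [hexp _ (fun r hr => hint _ (feInterp_mem 𝒯 _) r hr) r hr, hexp φ hφ r hr]
  refine Finset.sum_congr rfl fun b _ => ?_
  rw [← hm, hc]

/-! ### Stability of the `L²(Ω)` projection in the maximum norm -/

/-- An integrable weight, centred at `z` and varying slowly on the scale `h`. -/
noncomputable def weight {M : ℕ} (δ h : ℝ) (z x : E M) : ℝ :=
  ((1 + ‖(δ / h) • (x - z)‖) ^ (M + 1))⁻¹

lemma weight_pos (δ h : ℝ) (z x : E M) : 0 < weight δ h z x := by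
  unfold weight; positivity

lemma weight_self (δ h : ℝ) (z : E M) : weight δ h z z = 1 := by simp [weight]

lemma weight_le {δ h : ℝ} (hδ : 0 < δ) (hh : 0 < h) (z : E M) {x y : E M} (hxy : ‖x - y‖ ≤ h) :
    weight δ h z x ≤ (1 + δ) ^ (M + 1) * weight δ h z y := by
  unfold weight
  rw [← div_eq_mul_inv, inv_eq_one_div, div_le_div_iff₀ (by positivity) (by positivity), one_mul,
    ← mul_pow]
  refine pow_le_pow_left₀ (by positivity) ?_ _
  have h1 : ‖(δ / h) • (y - z)‖ ≤ ‖(δ / h) • (x - z)‖ + δ := by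
    have h2 : (δ / h) • (y - z) = (δ / h) • (x - z) - (δ / h) • (x - y) := by
      rw [← smul_sub]; congr 1; abel
    rw [h2]
    refine (norm_sub_le _ _).trans ?_
    gcongr
    rw [norm_smul, Real.norm_eq_abs, abs_of_pos (by positivity), div_mul_eq_mul_div,
      div_le_iff₀ hh]
    gcongr
  nlinarith [norm_nonneg ((δ / h) • (x - z)), mul_nonneg hδ.le (norm_nonneg ((δ / h) • (x - z)))]

/-- The integral of the weight `(1 + ‖x‖)⁻⁽ᴹ⁺¹⁾`. -/
noncomputable def weightInt (M : ℕ) : ℝ := ∫ x : E M, ((1 + ‖x‖) ^ (M + 1))⁻¹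

lemma integrable_weight_one (M : ℕ) : Integrable fun x : E M => ((1 + ‖x‖) ^ (M + 1))⁻¹ := by
  have h := integrable_one_add_norm (E := E M) (μ := volume) (r := ((M + 1 : ℕ) : ℝ))
    (by simp)
  refine h.congr (Eventually.of_forall fun x => ?_)
  show (1 + ‖x‖) ^ (-((M + 1 : ℕ) : ℝ)) = _
  rw [Real.rpow_neg (by positivity), Real.rpow_natCast]

lemma integrable_weight {δ h : ℝ} (hδ : 0 < δ) (hh : 0 < h) (z : E M) :
    Integrable (weight δ h z) := by
  have h1 : Integrable fun x : E M => ((1 + ‖(δ / h) • x‖) ^ (M + 1))⁻¹ :=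
    (integrable_weight_one M).comp_smul (by positivity)
  exact h1.comp_sub_right z

lemma integral_weight {δ h : ℝ} (hδ : 0 < δ) (hh : 0 < h) (z : E M) :
    ∫ x, weight δ h z x = (h / δ) ^ M * weightInt M := by
  unfold weight
  rw [integral_sub_right_eq_self (fun x : E M => ((1 + ‖(δ / h) • x‖) ^ (M + 1))⁻¹) z,
    Measure.integral_comp_smul volume (fun x : E M => ((1 + ‖x‖) ^ (M + 1))⁻¹) (δ / h),
    abs_of_nonneg (by positivity), smul_eq_mul, weightInt]
  simp [← inv_pow]

/-- The constant `δ` in the weight is so small that the weight varies over an element as little as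
`weighted_le_integral_mul` requires. -/
lemma exists_slow (M : ℕ) : ∃ δ : ℝ, 0 < δ ∧ (1 + δ) ^ (M + 1) ≤ 1 + massConst M / 2 := by
  have hc : Continuous fun δ : ℝ => (1 + δ) ^ (M + 1) := by fun_prop
  have h1 : ∀ᶠ δ in 𝓝[>] (0 : ℝ), (1 + δ) ^ (M + 1) < 1 + massConst M / 2 :=
    ((hc.tendsto 0).mono_left nhdsWithin_le_nhds).eventually_lt_const
      (by have := massConst_pos M; simp; linarith)
  obtain ⟨δ, h2, h3⟩ := (h1.and self_mem_nhdsWithin).exists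
  exact ⟨δ, h3, h2.le⟩

/-- Testing the projection `p` of `φ` with the interpolant of `w * p`, where `w` is the weight
centred at a node `z`, bounds `∑ |K| ∑ w a * p a ^ 2`, and with it `|p z|`, by the integral
of `w`, which has the size `h ^ M` of a single element. -/
lemma exists_projection_bound (M : ℕ) {ρ : ℝ} (hρ : 0 < ρ) :
    ∃ C : ℝ, 0 ≤ C ∧ ∀ (Ω : Set (E M)) (𝒯 : Triangulation Ω) (h : ℝ),
      HasLipschitzBoundary Ω → IsOpen Ω → 𝒯.IsRegular ρ h → ∀ (φ : E M → ℝ) (Φ : ℝ),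
      (∀ᵐ x ∂(volume.restrict Ω), |φ x| ≤ Φ) → ∀ p ∈ feSpace 𝒯 ℝ,
      (∀ r ∈ feSpace 𝒯 ℝ, ∫ x in Ω, p x * r x = ∫ x in Ω, φ x * r x) →
      ∀ a ∈ 𝒯.nodes, |p a| ≤ C * Φ := by
  obtain ⟨δ, hδ, hδM⟩ := exists_slow M
  set κ := massConst M with hκdef
  have hκ : 0 < κ := massConst_pos M
  have hκ1 : κ ≤ 1 := massConst_le_one M
  set k : ℝ := κ / (4 * (M + 1)) with hk
  have hkpos : 0 < k := by positivity
  have hV := unitBallVol_pos M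
  have hJ : 0 ≤ weightInt M := integral_nonneg fun x => by positivity
  refine ⟨Real.sqrt (2 * (M + 1) * weightInt M / (k ^ 2 * unitBallVol M * (ρ * δ) ^ M)),
    Real.sqrt_nonneg _, ?_⟩
  intro Ω 𝒯 h hlip hΩ hreg φ Φ hφ p hp hproj z hz
  have hh := hreg.h_pos
  obtain ⟨s₀, hs₀, hzs₀⟩ := Triangulation.exists_elem_of_mem_nodes hz
  have hΦ : 0 ≤ Φ := by
    have hne : (volume.restrict Ω : Measure (E M)) ≠ 0 := by
      rw [𝒯.restrict_eq_restrict_closure hlip hΩ, Ne, Measure.restrict_eq_zero]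
      intro h0
      have := hreg.simplexVol_pos hρ hs₀
      rw [simplexVol, Measure.real, measure_mono_null (Triangulation.elem_subset_closure hs₀) h0]
        at this
      simp at this
    have := ae_neBot.2 hne
    obtain ⟨x, hx⟩ := hφ.exists
    exact (abs_nonneg _).trans hx
  set w : E M → ℝ := weight δ h z with hw
  have hwpos : ∀ x, 0 < w x := weight_pos δ h z
  have hwle : ∀ s ∈ 𝒯.elems, ∀ x ∈ convexHull ℝ (s : Set (E M)),
      ∀ y ∈ convexHull ℝ (s : Set (E M)), w x ≤ (1 + κ / 2) * w y := fun s hs x hx y hy =>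
    (weight_le hδ hh z (hreg.norm_sub_le s hs x hx y hy)).trans
      (mul_le_mul_of_nonneg_right hδM (hwpos y).le)
  set r : E M → ℝ := feInterp 𝒯 (fun a => w a * p a) with hr
  have hrmem : r ∈ feSpace 𝒯 ℝ := feInterp_mem 𝒯 _
  have hra : ∀ a ∈ 𝒯.nodes, r a = w a * p a := fun a ha => feInterp_apply _ ha
  set X : ℝ := ∑ s ∈ 𝒯.elemFinset, simplexVol s * ∑ a ∈ s, w a * p a ^ 2 with hX
  set Y : ℝ := ∑ s ∈ 𝒯.elemFinset, simplexVol s * ∑ a ∈ s, w a with hY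
  -- coercivity, element by element
  have hlow : k * X ≤ ∫ x in Ω, p x * r x := by
    rw [𝒯.setIntegral_eq_sum hlip hΩ (integrableOn_mul_of_mem_feSpace hp hrmem), hX,
      Finset.mul_sum]
    refine Finset.sum_le_sum fun s hs => ?_
    rw [Triangulation.mem_elemFinset] at hs
    obtain ⟨A, hA⟩ := hp.2 s hs
    obtain ⟨B, hB⟩ := hrmem.2 s hs
    have hsub : ∀ a ∈ s, a ∈ convexHull ℝ (s : Set (E M)) := fun a ha => subset_convexHull ℝ _ ha
    have h1 := weighted_le_integral_mul s A B w (fun a _ => hwpos a)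
      (fun a ha b hb => hwle s hs a (hsub a ha) b (hsub b hb))
      (fun a ha => by
        rw [← hA (hsub a ha), ← hB (hsub a ha)]
        exact hra a (Triangulation.mem_nodes_of_mem hs ha))
    have h2 : ∫ x in convexHull ℝ (s : Set (E M)), p x * r x
        = ∫ x in convexHull ℝ (s : Set (E M)), A x * B x :=
      setIntegral_congr_fun (isCompact_simplex s).measurableSet fun x hx => by
        simp only [hA hx, hB hx]
    have h3 : ∑ a ∈ s, w a * p a ^ 2 = ∑ a ∈ s, w a * A a ^ 2 :=
      Finset.sum_congr rfl fun a ha => by rw [hA (hsub a ha)]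
    rw [h2, h3, hk]
    rw [hs.2] at h1
    push_cast at h1
    have hM1 : (0 : ℝ) < M + 1 := by positivity
    calc κ / (4 * (M + 1)) * (simplexVol s * ∑ a ∈ s, w a * A a ^ 2)
        = (κ / 4 * simplexVol s * ∑ a ∈ s, w a * A a ^ 2) / (M + 1) := by field_simp
      _ ≤ _ := by rw [div_le_iff₀ hM1]; linarith
  have hup : ∫ x in Ω, φ x * r x ≤ k / 2 * X + Φ ^ 2 / (2 * k) * Y := by
    have hrint : IntegrableOn (fun x => |r x|) (closure Ω) :=
      (hrmem.1.abs).integrableOn_compact 𝒯.isCompact_closure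
    have h1 : ∫ x in Ω, φ x * r x ≤ ∫ x in Ω, Φ * |r x| := by
      refine (le_abs_self _).trans ?_
      rw [← Real.norm_eq_abs]
      refine norm_integral_le_of_norm_le ((hrint.mono_set subset_closure).const_mul Φ) ?_
      filter_upwards [hφ] with x hx
      rw [norm_mul, Real.norm_eq_abs, Real.norm_eq_abs]
      gcongr
    refine h1.trans ?_
    rw [integral_const_mul, 𝒯.setIntegral_eq_sum hlip hΩ hrint, hX, hY, Finset.mul_sum,
      Finset.mul_sum, Finset.mul_sum, ← Finset.sum_add_distrib]
    refine Finset.sum_le_sum fun s hs => ?_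
    rw [Triangulation.mem_elemFinset] at hs
    have h2 : ∫ x in convexHull ℝ (s : Set (E M)), |r x|
        ≤ simplexVol s * ∑ a ∈ s, w a * |p a| := by
      have h3 : ∀ x ∈ convexHull ℝ (s : Set (E M)), |r x| ≤ ∑ a ∈ s, w a * |p a| := by
        intro x hx
        refine abs_le_of_mem_feSpace hrmem hs (fun a ha => ?_) hx
        rw [hra a (Triangulation.mem_nodes_of_mem hs ha), abs_mul, abs_of_pos (hwpos a)]
        exact Finset.single_le_sum (f := fun a => w a * |p a|)
          (fun b _ => mul_nonneg (hwpos b).le (abs_nonneg _)) ha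
      have h4 := setIntegral_mono_on
        (hrint.mono_set (Triangulation.elem_subset_closure hs))
        (integrableOn_const (isCompact_simplex s).measure_ne_top)
        (isCompact_simplex s).measurableSet h3
      rwa [setIntegral_const] at h4
    have h5 : Φ * ∑ a ∈ s, w a * |p a|
        ≤ k / 2 * ∑ a ∈ s, w a * p a ^ 2 + Φ ^ 2 / (2 * k) * ∑ a ∈ s, w a := by
      rw [Finset.mul_sum, Finset.mul_sum, Finset.mul_sum, ← Finset.sum_add_distrib]
      refine Finset.sum_le_sum fun a _ => ?_
      -- Young's inequality
      have h6 : Φ * |p a| ≤ k / 2 * p a ^ 2 + Φ ^ 2 / (2 * k) := by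
        rw [← sq_abs (p a)]
        have h7 : k / 2 * |p a| ^ 2 + Φ ^ 2 / (2 * k) - Φ * |p a|
            = (k * |p a| - Φ) ^ 2 / (2 * k) := by field_simp; ring
        have h8 : 0 ≤ (k * |p a| - Φ) ^ 2 / (2 * k) := by positivity
        linarith
      nlinarith [mul_le_mul_of_nonneg_left h6 (hwpos a).le]
    calc Φ * ∫ x in convexHull ℝ (s : Set (E M)), |r x|
        ≤ Φ * (simplexVol s * ∑ a ∈ s, w a * |p a|) := by gcongr
      _ = simplexVol s * (Φ * ∑ a ∈ s, w a * |p a|) := by ring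
      _ ≤ simplexVol s * (k / 2 * ∑ a ∈ s, w a * p a ^ 2
            + Φ ^ 2 / (2 * k) * ∑ a ∈ s, w a) :=
          mul_le_mul_of_nonneg_left h5 (simplexVol_nonneg s)
      _ = _ := by ring
  have hXY : k ^ 2 * X ≤ Φ ^ 2 * Y := by
    rw [hproj r hrmem] at hlow
    have h1 : k / 2 * X ≤ Φ ^ 2 / (2 * k) * Y := by linarith
    have h2 := mul_le_mul_of_nonneg_left h1 (by positivity : 0 ≤ 2 * k)
    have h3 : 2 * k * (k / 2 * X) = k ^ 2 * X := by ring
    have h4 : 2 * k * (Φ ^ 2 / (2 * k) * Y) = Φ ^ 2 * Y := by field_simp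
    rwa [h3, h4] at h2
  have hYle : Y ≤ 2 * (M + 1) * ((h / δ) ^ M * weightInt M) := by
    have hwint := integrable_weight hδ hh z
    rw [← integral_weight hδ hh z]
    have h1 : ∫ x in Ω, w x ≤ ∫ x, w x :=
      setIntegral_le_integral hwint (Eventually.of_forall fun x => (hwpos x).le)
    refine le_trans ?_ (mul_le_mul_of_nonneg_left h1 (by positivity))
    rw [𝒯.setIntegral_eq_sum hlip hΩ hwint.integrableOn, hY, Finset.mul_sum]
    refine Finset.sum_le_sum fun s hs => ?_
    rw [Triangulation.mem_elemFinset] at hs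
    have h2 : ∀ a ∈ s, simplexVol s * w a ≤ 2 * ∫ x in convexHull ℝ (s : Set (E M)), w x := by
      intro a ha
      rw [← integral_const_mul, ← smul_eq_mul, simplexVol, ← setIntegral_const]
      refine setIntegral_mono_on (integrableOn_const (isCompact_simplex s).measure_ne_top)
        (hwint.integrableOn.const_mul 2) (isCompact_simplex s).measurableSet fun x hx => ?_
      have h3 := hwle s hs a (subset_convexHull ℝ _ ha) x hx
      nlinarith [hwpos x]
    rw [Finset.mul_sum]
    refine (Finset.sum_le_card_nsmul _ _ _ h2).trans (le_of_eq ?_)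
    rw [hs.2, nsmul_eq_mul]
    push_cast
    ring
  have hXge : (ρ * h) ^ M * unitBallVol M * p z ^ 2 ≤ X := by
    have h1 : simplexVol s₀ * (w z * p z ^ 2) ≤ X := by
      have h2 : w z * p z ^ 2 ≤ ∑ a ∈ s₀, w a * p a ^ 2 :=
        Finset.single_le_sum (f := fun a => w a * p a ^ 2)
          (fun b _ => mul_nonneg (hwpos b).le (sq_nonneg _)) hzs₀
      refine (mul_le_mul_of_nonneg_left h2 (simplexVol_nonneg s₀)).trans ?_
      exact Finset.single_le_sum (f := fun s => simplexVol s * ∑ a ∈ s, w a * p a ^ 2)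
        (fun s _ => mul_nonneg (simplexVol_nonneg s) (Finset.sum_nonneg fun b _ =>
          mul_nonneg (hwpos b).le (sq_nonneg _))) (Triangulation.mem_elemFinset.2 hs₀)
    rw [hw, weight_self, one_mul] at h1
    exact (mul_le_mul_of_nonneg_right (hreg.le_simplexVol hρ hs₀) (sq_nonneg _)).trans h1
  have hfin : p z ^ 2
      ≤ 2 * (M + 1) * weightInt M / (k ^ 2 * unitBallVol M * (ρ * δ) ^ M) * Φ ^ 2 := by
    have h1 : k ^ 2 * ((ρ * h) ^ M * unitBallVol M * p z ^ 2)
        ≤ Φ ^ 2 * (2 * (M + 1) * ((h / δ) ^ M * weightInt M)) :=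
      (mul_le_mul_of_nonneg_left hXge (by positivity)).trans
        (hXY.trans (mul_le_mul_of_nonneg_left hYle (by positivity)))
    rw [div_mul_eq_mul_div, le_div_iff₀ (by positivity)]
    have hhM : 0 < (h / δ) ^ M := by positivity
    refine le_of_mul_le_mul_left ?_ hhM
    have h2 : (h / δ) ^ M * (ρ * δ) ^ M = (ρ * h) ^ M := by
      rw [← mul_pow]; congr 1; field_simp
    calc (h / δ) ^ M * (p z ^ 2 * (k ^ 2 * unitBallVol M * (ρ * δ) ^ M))
        = k ^ 2 * (((h / δ) ^ M * (ρ * δ) ^ M) * unitBallVol M * p z ^ 2) := by ring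
      _ ≤ Φ ^ 2 * (2 * (M + 1) * ((h / δ) ^ M * weightInt M)) := by rw [h2]; exact h1
      _ = _ := by ring
  rw [← Real.sqrt_sq hΦ, ← Real.sqrt_mul (by positivity)]
  exact Real.abs_le_sqrt hfin

end Regular

/-! ### Gradients of finite element functions -/

section Gradients

variable {M : ℕ} {Ω : Set (E M)} {𝒯 : Triangulation Ω} {F : Type*} [NormedAddCommGroup F]
  [NormedSpace ℝ F]

lemma hasFDerivAt_of_eqOn_affine {K : Set (E M)} {v : E M → F} {A : E M →ᵃ[ℝ] F}
    (hA : EqOn v A K) {x : E M} (hx : x ∈ interior K) :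
    HasFDerivAt v (LinearMap.toContinuousLinearMap A.linear) x := by
  have h1 : HasFDerivAt A (LinearMap.toContinuousLinearMap A.linear) x := by
    have h2 : (A : E M → F) = fun y => (LinearMap.toContinuousLinearMap A.linear) y + A 0 := by
      ext y
      have := congrFun A.decomp y
      simpa using this
    rw [h2]
    exact (LinearMap.toContinuousLinearMap A.linear).hasFDerivAt.add_const _
  exact h1.congr_of_eventuallyEq (hA.eventuallyEq_of_mem (mem_interior_iff_mem_nhds.1 hx))

lemma fePartial_eq_of_eqOn_affine {K : Set (E M)} {v : E M → F} {A : E M →ᵃ[ℝ] F}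
    (hA : EqOn v A K) {x : E M} (hx : x ∈ interior K) (j : Fin M) :
    fePartial v j x = A.linear (basisVec j) := by
  rw [fePartial, (hasFDerivAt_of_eqOn_affine hA hx).fderiv]
  rfl

lemma ae_fePartial_eq (hΩ : IsOpen Ω) {v : E M → F} (hv : v ∈ feSpace 𝒯 F) :
    ∀ᵐ x ∂(volume.restrict Ω), ∀ j,
      fePartial v j x = ∑ a ∈ 𝒯.nodeFinset, fePartial (hat 𝒯 a) j x • v a := by
  filter_upwards [𝒯.ae_mem_interior_elem, ae_restrict_mem hΩ.measurableSet] with x hx hxΩ j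
  obtain ⟨s, hs, hxs⟩ := hx
  have hd : ∀ a, DifferentiableAt ℝ (hat 𝒯 a) x := fun a => by
    obtain ⟨A, hA⟩ := (hat_mem 𝒯 a).2 s hs
    exact (hasFDerivAt_of_eqOn_affine hA hxs).differentiableAt
  have heq : v =ᶠ[𝓝 x] feInterp 𝒯 v :=
    ((eqOn_feInterp hv fun _ _ => rfl).mono subset_closure).eventuallyEq_of_mem (hΩ.mem_nhds hxΩ)
  have h1 : HasFDerivAt (feInterp 𝒯 v)
      (∑ a ∈ 𝒯.nodeFinset, (fderiv ℝ (hat 𝒯 a) x).smulRight (v a)) x :=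
    HasFDerivAt.fun_sum fun a _ => (hd a).hasFDerivAt.smul_const (v a)
  rw [fePartial, heq.fderiv_eq, h1.fderiv]
  simp [fePartial]

lemma integrableOn_fePartial_mul {p r : E M → ℝ} (hp : p ∈ feSpace 𝒯 ℝ) (hr : r ∈ feSpace 𝒯 ℝ)
    (j : Fin M) : IntegrableOn (fun x => fePartial p j x * fePartial r j x) Ω := by
  have hbd : ∀ p ∈ feSpace 𝒯 ℝ, ∃ C : ℝ, ∀ᵐ x ∂(volume.restrict Ω), |fePartial p j x| ≤ C := by
    intro p hp
    choose! A hA using hp.2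
    refine ⟨∑ s ∈ 𝒯.elemFinset, |(A s).linear (basisVec j)|, ?_⟩
    filter_upwards [𝒯.ae_mem_interior_elem] with x hx
    obtain ⟨s, hs, hxs⟩ := hx
    rw [fePartial_eq_of_eqOn_affine (hA s hs) hxs]
    exact Finset.single_le_sum (f := fun s => |(A s).linear (basisVec j)|)
      (fun _ _ => abs_nonneg _) (Triangulation.mem_elemFinset.2 hs)
  obtain ⟨C, hC⟩ := hbd p hp
  obtain ⟨D, hD⟩ := hbd r hr
  refine Measure.integrableOn_of_bounded (M := C * D)
    ((measure_mono subset_closure).trans_lt 𝒯.isCompact_closure.measure_lt_top).ne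
    ((measurable_fderiv_apply_const ℝ p _).mul
      (measurable_fderiv_apply_const ℝ r _)).aestronglyMeasurable ?_
  filter_upwards [hC, hD] with x h1 h2
  rw [norm_mul]
  exact mul_le_mul h1 h2 (abs_nonneg _) ((abs_nonneg _).trans h1)

/-- The stiffness matrix of the mesh. -/
noncomputable def stiffness (𝒯 : Triangulation Ω) (a b : E M) : ℝ :=
  ∫ x in Ω, ∑ j, fePartial (hat 𝒯 a) j x * fePartial (hat 𝒯 b) j x

lemma stiffness_comm (a b : E M) : stiffness 𝒯 a b = stiffness 𝒯 b a := by
  simp only [stiffness, mul_comm]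

lemma ae_sum_inner_fePartial_eq (hΩ : IsOpen Ω) {u v : E M → E M} (hu : u ∈ feSpace 𝒯 (E M))
    (hv : v ∈ feSpace 𝒯 (E M)) :
    (fun x => ∑ j, inner ℝ (fePartial u j x) (fePartial v j x)) =ᵐ[volume.restrict Ω]
      fun x => ∑ a ∈ 𝒯.nodeFinset, ∑ b ∈ 𝒯.nodeFinset,
        (∑ j, fePartial (hat 𝒯 a) j x * fePartial (hat 𝒯 b) j x) * inner ℝ (u a) (v b) := by
  filter_upwards [ae_fePartial_eq hΩ hu, ae_fePartial_eq hΩ hv] with x h1 h2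
  simp only [h1, h2, sum_inner, inner_sum, real_inner_smul_left, real_inner_smul_right,
    Finset.sum_mul]
  rw [Finset.sum_comm]
  conv_rhs => rw [Finset.sum_comm]
  refine Finset.sum_congr rfl fun b _ => ?_
  rw [Finset.sum_comm]
  refine Finset.sum_congr rfl fun a _ => Finset.sum_congr rfl fun j _ => ?_
  ring

lemma integrableOn_sum_fePartial_mul (a b : E M) :
    IntegrableOn (fun x => ∑ j, fePartial (hat 𝒯 a) j x * fePartial (hat 𝒯 b) j x) Ω :=
  integrable_finsetSum _ fun j _ => integrableOn_fePartial_mul (hat_mem 𝒯 a) (hat_mem 𝒯 b) j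

lemma integrableOn_sum_inner_fePartial (hΩ : IsOpen Ω) {u v : E M → E M}
    (hu : u ∈ feSpace 𝒯 (E M)) (hv : v ∈ feSpace 𝒯 (E M)) :
    IntegrableOn (fun x => ∑ j, inner ℝ (fePartial u j x) (fePartial v j x)) Ω := by
  refine Integrable.congr ?_ (ae_sum_inner_fePartial_eq hΩ hu hv).symm
  exact integrable_finsetSum _ fun a _ => integrable_finsetSum _ fun b _ =>
    (integrableOn_sum_fePartial_mul a b).mul_const _

lemma gradInner_eq_sum (hΩ : IsOpen Ω) {u v : E M → E M} (hu : u ∈ feSpace 𝒯 (E M))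
    (hv : v ∈ feSpace 𝒯 (E M)) :
    gradInner Ω u v
      = ∑ a ∈ 𝒯.nodeFinset, ∑ b ∈ 𝒯.nodeFinset, stiffness 𝒯 a b * inner ℝ (u a) (v b) := by
  rw [gradInner, integral_congr_ae (ae_sum_inner_fePartial_eq hΩ hu hv),
    integral_finsetSum 𝒯.nodeFinset (fun a _ => integrable_finsetSum 𝒯.nodeFinset fun b _ =>
      (integrableOn_sum_fePartial_mul a b).mul_const (inner ℝ (u a) (v b)))]
  refine Finset.sum_congr rfl fun a _ => ?_
  rw [integral_finsetSum 𝒯.nodeFinset fun b _ =>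
    (integrableOn_sum_fePartial_mul a b).mul_const (inner ℝ (u a) (v b))]
  simp only [integral_mul_const, stiffness]

lemma abs_gradInner_le {ρ h : ℝ} (hΩ : IsOpen Ω) (hreg : 𝒯.IsRegular ρ h) (hρ : 0 < ρ)
    {u v : E M → E M} (hu : u ∈ feSpace 𝒯 (E M)) (hv : v ∈ feSpace 𝒯 (E M)) {c : E M → ℝ} {B : ℝ}
    (hB : ∀ a ∈ 𝒯.nodes, |c a| ≤ B) (hunit : ∀ a ∈ 𝒯.nodes, ‖u a‖ = 1)
    (huv : ∀ a ∈ 𝒯.nodes, v a = c a • u a) :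
    |gradInner Ω u v| ≤ ((M + 1) ^ 2 * (M / ρ ^ 2)) * B * gradInner Ω u u := by
  rw [gradInner, gradInner, ← integral_const_mul]
  rw [← Real.norm_eq_abs]
  refine norm_integral_le_of_norm_le ((integrableOn_sum_inner_fePartial hΩ hu hu).const_mul _) ?_
  filter_upwards [𝒯.ae_mem_interior_elem] with x hx
  obtain ⟨s, hs, hxs⟩ := hx
  obtain ⟨U, hU⟩ := hu.2 s hs
  obtain ⟨V, hV⟩ := hv.2 s hs
  obtain ⟨y, hy⟩ := hreg.exists_ball s hs
  have hsub : ∀ a ∈ s, a ∈ convexHull ℝ (s : Set (E M)) := fun a ha => subset_convexHull ℝ _ ha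
  have hnode : ∀ a ∈ s, a ∈ 𝒯.nodes := fun a ha => Triangulation.mem_nodes_of_mem hs ha
  simp only [fePartial_eq_of_eqOn_affine hU hxs, fePartial_eq_of_eqOn_affine hV hxs,
    real_inner_self_eq_norm_sq]
  refine abs_sum_inner_partial_le s (𝒯.complex.indep hs.1) hs.2 hρ hreg.h_pos hy
    (fun a ha b hb => hreg.norm_sub_le s hs a (hsub a ha) b (hsub b hb)) U V c
    (fun a ha => hB a (hnode a ha)) (fun a ha => ?_) (fun a ha => ?_)
  · rw [← hU (hsub a ha)]; exact hunit a (hnode a ha)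
  · rw [← hU (hsub a ha), ← hV (hsub a ha)]; exact huv a (hnode a ha)

end Gradients

/-! ### The semi-discrete flow -/

section Flow

variable {M : ℕ} {Ω : Set (E M)} {𝒯 : Triangulation Ω}

lemma inner_vecCross_left (a b : E M) : inner ℝ (vecCross a b) a = 0 := by
  unfold vecCross
  split
  · simp [PiLp.inner_apply, Fin.sum_univ_three, crossProduct]; ring
  · simp

lemma inner_vecCross_right (a b : E M) : inner ℝ (vecCross a b) b = 0 := by
  unfold vecCross
  split
  · simp [PiLp.inner_apply, Fin.sum_univ_three, crossProduct]; ring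
  · simp

lemma setIntegral_nodalInterp_eq_zero (hΩ : IsOpen Ω) {c : E M → ℝ} (hc : ∀ a ∈ 𝒯.nodes, c a = 0)
    (f : E M → ℝ) : ∫ x in Ω, f x * nodalInterp 𝒯 c x = 0 := by
  have h := eqOn_nodalInterp (𝒯 := 𝒯) (Submodule.zero_mem (feSpace 𝒯 ℝ)) (c := c)
    (fun a ha => (hc a ha).symm)
  rw [setIntegral_congr_fun (g := fun _ => (0 : ℝ)) hΩ.measurableSet fun x hx => by
    simp [← h (subset_closure hx)]]
  simp

lemma lumpedInner_eq_zero (hΩ : IsOpen Ω) {u v : E M → E M}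
    (h : ∀ a ∈ 𝒯.nodes, inner ℝ (u a) (v a) = 0) : lumpedInner 𝒯 u v = 0 := by
  simpa [lumpedInner] using setIntegral_nodalInterp_eq_zero hΩ h (fun _ => 1)

lemma lumpedInner_nonneg (hΩ : IsOpen Ω) {u v : E M → E M}
    (h : ∀ a ∈ 𝒯.nodes, 0 ≤ inner ℝ (u a) (v a)) : 0 ≤ lumpedInner 𝒯 u v := by
  refine setIntegral_nonneg hΩ.measurableSet fun x hx => ?_
  obtain ⟨s, hs, hxs⟩ := Triangulation.exists_elem_of_mem_closure (𝒯 := 𝒯) (subset_closure hx)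
  obtain ⟨A, hA⟩ := (nodalInterp_mem 𝒯 fun y => inner ℝ (u y) (v y)).2 s hs
  rw [hA hxs]
  refine convexHull_min (fun a ha => ?_) ((convex_Ici (0 : ℝ)).affine_preimage A) hxs
  have ha' := Triangulation.mem_nodes_of_mem hs ha
  show 0 ≤ A a
  rw [← hA (subset_convexHull ℝ _ ha), nodalInterp_apply _ ha']
  exact h a ha'

variable {γ α : ℝ} {u0h : E M → E M} {u : ℝ → E M → E M} {q : ℝ → E M → ℝ} {ρ h : ℝ}

lemma IsFEMSolution.norm_eq_one (hsol : IsFEMSolution 𝒯 γ α u0h u q)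
    (hlip : HasLipschitzBoundary Ω) (hΩ : IsOpen Ω) (hreg : 𝒯.IsRegular ρ h) (hρ : 0 < ρ)
    {t : ℝ} (ht : 0 ≤ t) {a : E M} (ha : a ∈ 𝒯.nodes) : ‖u t a‖ = 1 := by
  set p := nodalInterp 𝒯 fun y => inner ℝ (u t y) (u t y) with hp
  have hpmem : p ∈ feSpace 𝒯 ℝ := nodalInterp_mem _ _
  have h1mem : (fun _ => (1 : ℝ)) ∈ feSpace 𝒯 ℝ :=
    ⟨continuousOn_const, fun s _ => ⟨AffineMap.const ℝ _ 1, fun _ _ => rfl⟩⟩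
  have hmem : (fun x => p x - 1) ∈ feSpace 𝒯 ℝ := Submodule.sub_mem _ hpmem h1mem
  have hint : ∀ v ∈ feSpace 𝒯 ℝ, ∀ w ∈ feSpace 𝒯 ℝ, IntegrableOn (fun x => v x * w x) Ω :=
    fun v hv w hw => (integrableOn_mul_of_mem_feSpace hv hw).mono_set subset_closure
  have h0 : ∫ x in Ω, (p x - 1) * (p x - 1) = 0 := by
    have h1 := hsol.sphere t ht _ hmem
    have h2 : ∀ x, (p x - 1) * (p x - 1) = p x * (p x - 1) - 1 * (p x - 1) := fun x => by ring
    simp only [h2]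
    rw [integral_sub (hint _ hpmem _ hmem) (hint _ h1mem _ hmem)]
    exact sub_eq_zero.2 h1
  have h3 := eq_zero_of_integral_mul_self_eq_zero hlip hΩ hreg hρ hmem h0 a ha
  simp only [hp, nodalInterp_apply _ ha, real_inner_self_eq_norm_sq, sub_eq_zero] at h3
  exact (pow_eq_one_iff_of_nonneg (norm_nonneg _) two_ne_zero).1 h3

lemma IsFEMSolution.hasDerivWithinAt (hsol : IsFEMSolution 𝒯 γ α u0h u q) {t : ℝ} (ht : 0 ≤ t)
    {a : E M} (ha : a ∈ 𝒯.nodes) :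
    HasDerivWithinAt (fun s => u s a) (timeDeriv u t a) (Ici 0) t :=
  ((hsol.smooth_u.2 a (Triangulation.mem_closure_of_mem_nodes ha)).differentiableOn
    (by simp) t ht).hasDerivWithinAt

lemma IsFEMSolution.inner_timeDeriv_eq_zero (hsol : IsFEMSolution 𝒯 γ α u0h u q)
    (hlip : HasLipschitzBoundary Ω) (hΩ : IsOpen Ω) (hreg : 𝒯.IsRegular ρ h) (hρ : 0 < ρ)
    {t : ℝ} (ht : 0 ≤ t) {a : E M} (ha : a ∈ 𝒯.nodes) :
    inner ℝ (u t a) (timeDeriv u t a) = 0 := by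
  have h1 := hsol.hasDerivWithinAt ht ha
  have h2 := h1.inner ℝ h1
  have h3 : HasDerivWithinAt (fun s => inner ℝ (u s a) (u s a)) (0 : ℝ) (Ici 0) t :=
    (hasDerivWithinAt_const t (Ici (0 : ℝ)) (1 : ℝ)).congr_of_mem (fun s hs => by
      rw [real_inner_self_eq_norm_sq, hsol.norm_eq_one hlip hΩ hreg hρ hs ha, one_pow]) ht
  have h4 := (uniqueDiffOn_Ici (0 : ℝ) t ht).eq_deriv _ h2 h3
  rw [real_inner_comm (u t a) (timeDeriv u t a)] at h4
  linarith

/-- The energy law: the momentum equation is tested with the time derivative of `u`, which is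
orthogonal to `u` at the nodes. -/
lemma IsFEMSolution.gradInner_le (hsol : IsFEMSolution 𝒯 γ α u0h u q) (hγ : 0 < γ)
    (hlip : HasLipschitzBoundary Ω) (hΩ : IsOpen Ω) (hreg : 𝒯.IsRegular ρ h) (hρ : 0 < ρ)
    {t : ℝ} (ht : 0 ≤ t) : gradInner Ω (u t) (u t) ≤ gradInner Ω (u 0) (u 0) := by
  set N := 𝒯.nodeFinset with hN
  have hnode : ∀ a ∈ N, a ∈ 𝒯.nodes := fun a ha => Triangulation.mem_nodeFinset.1 ha
  set e : ℝ → ℝ := fun t => ∑ a ∈ N, ∑ b ∈ N, stiffness 𝒯 a b * inner ℝ (u t a) (u t b) with he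
  set e' : ℝ → ℝ := fun t => ∑ a ∈ N, ∑ b ∈ N, stiffness 𝒯 a b *
    (inner ℝ (u t a) (timeDeriv u t b) + inner ℝ (timeDeriv u t a) (u t b)) with he'
  have hderiv : ∀ t ∈ Ici (0 : ℝ), HasDerivWithinAt e (e' t) (Ici 0) t := fun t ht =>
    HasDerivWithinAt.fun_sum fun a ha => HasDerivWithinAt.fun_sum fun b hb =>
      ((hsol.hasDerivWithinAt ht (hnode a ha)).inner ℝ
        (hsol.hasDerivWithinAt ht (hnode b hb))).const_mul _
  have hneg : ∀ t ∈ Ici (0 : ℝ), e' t ≤ 0 := by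
    intro t ht
    set v := feInterp 𝒯 (timeDeriv u t) with hv
    have hvmem : v ∈ feSpace 𝒯 (E M) := feInterp_mem 𝒯 _
    have hva : ∀ a ∈ 𝒯.nodes, v a = timeDeriv u t a := fun a ha => feInterp_apply _ ha
    have h1 : e' t = 2 * gradInner Ω (u t) v := by
      rw [gradInner_eq_sum hΩ (hsol.smooth_u.1 t ht) hvmem]
      have h2 : ∑ a ∈ N, ∑ b ∈ N, stiffness 𝒯 a b * inner ℝ (timeDeriv u t a) (u t b)
          = ∑ a ∈ N, ∑ b ∈ N, stiffness 𝒯 a b * inner ℝ (u t a) (timeDeriv u t b) := by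
        rw [Finset.sum_comm]
        refine Finset.sum_congr rfl fun a _ => Finset.sum_congr rfl fun b _ => ?_
        rw [stiffness_comm, real_inner_comm]
      have h3 : ∑ a ∈ N, ∑ b ∈ N, stiffness 𝒯 a b * inner ℝ (u t a) (v b)
          = ∑ a ∈ N, ∑ b ∈ N, stiffness 𝒯 a b * inner ℝ (u t a) (timeDeriv u t b) :=
        Finset.sum_congr rfl fun a _ => Finset.sum_congr rfl fun b hb => by
          rw [hva b (hnode b hb)]
      simp only [he', mul_add, Finset.sum_add_distrib]
      rw [h2, h3, two_mul]
    have hmom := hsol.momentum t ht v hvmem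
    rw [setIntegral_nodalInterp_eq_zero hΩ (fun a ha => by
        rw [hva a ha]; exact hsol.inner_timeDeriv_eq_zero hlip hΩ hreg hρ ht ha),
      lumpedInner_eq_zero (𝒯 := 𝒯) (u := fun y => vecCross (u t y) (timeDeriv u t y)) hΩ
        (fun a ha => by rw [hva a ha]; exact inner_vecCross_right _ _)] at hmom
    have hpos : 0 ≤ lumpedInner 𝒯 (timeDeriv u t) v :=
      lumpedInner_nonneg hΩ fun a ha => by rw [hva a ha]; exact real_inner_self_nonneg
    have h4 : γ * gradInner Ω (u t) v ≤ 0 := by linarith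
    have h5 : gradInner Ω (u t) v ≤ 0 := by
      by_contra hc
      have := mul_pos hγ (not_le.1 hc)
      linarith
    linarith
  have hanti : AntitoneOn e (Ici 0) := by
    refine antitoneOn_of_hasDerivWithinAt_nonpos (f' := e') (convex_Ici 0)
      (fun t ht => (hderiv t ht).continuousWithinAt)
      (fun t ht => (hderiv t (interior_subset ht)).mono interior_subset)
      (fun t ht => hneg t (interior_subset ht))
  rw [gradInner_eq_sum hΩ (hsol.smooth_u.1 t ht) (hsol.smooth_u.1 t ht),
    gradInner_eq_sum hΩ (hsol.smooth_u.1 0 self_mem_Ici) (hsol.smooth_u.1 0 self_mem_Ici)]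
  exact hanti self_mem_Ici ht ht

lemma IsFEMSolution.gradInner_le_sq (hsol : IsFEMSolution 𝒯 γ α u0h u q) (hγ : 0 < γ)
    (hlip : HasLipschitzBoundary Ω) (hΩ : IsOpen Ω) (hreg : 𝒯.IsRegular ρ h) (hρ : 0 < ρ)
    {t : ℝ} (ht : 0 ≤ t) :
    gradInner Ω (u t) (u t) ≤ gradNorm Ω (fePartial u0h) ^ 2 := by
  refine (hsol.gradInner_le hγ hlip hΩ hreg hρ ht).trans (le_of_eq ?_)
  rw [gradNorm, Real.sq_sqrt
    (integral_nonneg fun x => Finset.sum_nonneg fun j _ => sq_nonneg _), gradInner]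
  refine setIntegral_congr_fun hΩ.measurableSet fun x hx => ?_
  have h1 : u 0 =ᶠ[𝓝 x] u0h :=
    (hsol.initial.mono subset_closure).eventuallyEq_of_mem (hΩ.mem_nhds hx)
  simp only [fePartial, h1.fderiv_eq, real_inner_self_eq_norm_sq]

/-- Testing the momentum equation with the interpolant of `p • u` leaves only the gradient term:
at the nodes `u · (p • u) = p`, while the time derivative and the vector product
are orthogonal to `u`. -/
lemma IsFEMSolution.abs_integral_mul_le (hsol : IsFEMSolution 𝒯 γ α u0h u q) (hγ : 0 < γ)
    (hlip : HasLipschitzBoundary Ω) (hΩ : IsOpen Ω) (hreg : 𝒯.IsRegular ρ h) (hρ : 0 < ρ)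
    {t : ℝ} (ht : 0 ≤ t) {p : E M → ℝ} (hp : p ∈ feSpace 𝒯 ℝ) {B : ℝ}
    (hB : ∀ a ∈ 𝒯.nodes, |p a| ≤ B) :
    |∫ x in Ω, q t x * p x|
      ≤ ((M + 1) ^ 2 * (M / ρ ^ 2)) * B * gradInner Ω (u t) (u t) := by
  have hunit : ∀ a ∈ 𝒯.nodes, ‖u t a‖ = 1 := fun a ha =>
    hsol.norm_eq_one hlip hΩ hreg hρ ht ha
  set v := feInterp 𝒯 (fun a => p a • u t a) with hv
  have hvmem : v ∈ feSpace 𝒯 (E M) := feInterp_mem 𝒯 _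
  have hva : ∀ a ∈ 𝒯.nodes, v a = p a • u t a := fun a ha => feInterp_apply _ ha
  have hmom := hsol.momentum t ht v hvmem
  have hq : ∫ x in Ω, q t x * nodalInterp 𝒯 (fun y => inner ℝ (u t y) (v y)) x
      = ∫ x in Ω, q t x * p x := by
    have h1 := eqOn_nodalInterp (𝒯 := 𝒯) hp (c := fun y => inner ℝ (u t y) (v y))
      (fun a ha => by
        rw [hva a ha, real_inner_smul_right, real_inner_self_eq_norm_sq, hunit a ha]; ring)
    exact setIntegral_congr_fun hΩ.measurableSet fun x hx => by
      simp only [h1 (subset_closure hx)]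
  rw [hq, lumpedInner_eq_zero (𝒯 := 𝒯) (u := timeDeriv u t) hΩ (fun a ha => by
      rw [hva a ha, real_inner_smul_right, real_inner_comm,
        hsol.inner_timeDeriv_eq_zero hlip hΩ hreg hρ ht ha, mul_zero]),
    lumpedInner_eq_zero (𝒯 := 𝒯) (u := fun y => vecCross (u t y) (timeDeriv u t y)) hΩ
      (fun a ha => by rw [hva a ha, real_inner_smul_right, inner_vecCross_left, mul_zero])] at hmom
  have h2 : ∫ x in Ω, q t x * p x = -gradInner Ω (u t) v := by
    have h3 : γ * (gradInner Ω (u t) v + ∫ x in Ω, q t x * p x) = 0 := by linarith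
    have h4 := (mul_eq_zero.1 h3).resolve_left hγ.ne'
    linarith
  rw [h2, abs_neg]
  exact abs_gradInner_le hΩ hreg hρ (hsol.smooth_u.1 t ht) hvmem hB hunit hva

end Flow

/-! ### The multiplier as a functional on `L^∞(Ω)` -/

section Functional

variable {M : ℕ} {Ω : Set (E M)}

lemma ae_abs_le_norm (f : Lp ℝ ∞ (volume.restrict Ω : Measure (E M))) :
    ∀ᵐ x ∂(volume.restrict Ω), |f x| ≤ ‖f‖ := by
  have h1 : ∀ᵐ x ∂(volume.restrict Ω), ‖f x‖ₑ ≤ eLpNormEssSup f (volume.restrict Ω) :=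
    ae_le_eLpNormEssSup
  filter_upwards [h1] with x hx
  rw [Lp.norm_def, ← Real.norm_eq_abs, ← toReal_enorm, eLpNorm_exponent_top]
  refine ENNReal.toReal_mono ?_ hx
  rw [← eLpNorm_exponent_top]
  exact (Lp.memLp f).eLpNorm_lt_top.ne

lemma integrable_mul_Linf {g : E M → ℝ} (hg : IntegrableOn g Ω)
    (f : Lp ℝ ∞ (volume.restrict Ω : Measure (E M))) : IntegrableOn (fun x => g x * f x) Ω :=
  Integrable.mul_bdd (c := ‖f‖) hg (Lp.aestronglyMeasurable f) (ae_abs_le_norm f)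

/-- The functional `f ↦ (g, f)` on `L^∞(Ω)`, for an integrable function `g`. -/
noncomputable def pairing (g : E M → ℝ) (hg : IntegrableOn g Ω) :
    StrongDual ℝ (Lp ℝ ∞ (volume.restrict Ω : Measure (E M))) :=
  LinearMap.mkContinuous
    { toFun := fun f => ∫ x in Ω, g x * f x
      map_add' := fun f₁ f₂ => by
        rw [← integral_add (integrable_mul_Linf hg _) (integrable_mul_Linf hg _)]
        refine integral_congr_ae ?_
        filter_upwards [Lp.coeFn_add f₁ f₂] with x hx
        rw [hx, Pi.add_apply, mul_add]
      map_smul' := fun c f => by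
        rw [RingHom.id_apply, ← integral_smul]
        refine integral_congr_ae ?_
        filter_upwards [Lp.coeFn_smul c f] with x hx
        rw [hx, Pi.smul_apply]
        simp only [smul_eq_mul]
        ring }
    (∫ x in Ω, |g x|) (fun f => by
      rw [← integral_mul_const]
      refine norm_integral_le_of_norm_le (hg.abs.mul_const _) ?_
      filter_upwards [ae_abs_le_norm f] with x hx
      rw [norm_mul]
      exact mul_le_mul_of_nonneg_left hx (norm_nonneg _))

lemma pairing_apply (g : E M → ℝ) (hg : IntegrableOn g Ω)
    (f : Lp ℝ ∞ (volume.restrict Ω : Measure (E M))) :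
    pairing g hg f = ∫ x in Ω, g x * f x := rfl

/-- The inclusion of `H¹(Ω) ∩ L^∞(Ω)` into `L^∞(Ω)`. -/
noncomputable def toLinf (Ω : Set (E M)) : H1Linf Ω →L[ℝ] Lp ℝ ∞ (volume.restrict Ω) :=
  (WithLp.fstL 1 ℝ (Lp ℝ ∞ (volume.restrict Ω)) (Lp (E M) 2 (volume.restrict Ω))).comp
    (H1Linf Ω).subtypeL

lemma norm_toLinf_le (φ : H1Linf Ω) : ‖toLinf Ω φ‖ ≤ ‖φ‖ := WithLp.norm_fst_le _ _

variable {𝒯 : Triangulation Ω}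

lemma integrableOn_hat (a : E M) : IntegrableOn (hat 𝒯 a) Ω :=
  ((hat_mem 𝒯 a).1.integrableOn_compact 𝒯.isCompact_closure).mono_set subset_closure

/-- A finite element function, with its nodal values `c`, as a functional on `L^∞(Ω)`. -/
noncomputable def feFunctional (𝒯 : Triangulation Ω) (c : E M → ℝ) :
    StrongDual ℝ (Lp ℝ ∞ (volume.restrict Ω : Measure (E M))) :=
  ∑ a ∈ 𝒯.nodeFinset, c a • pairing (hat 𝒯 a) (integrableOn_hat a)

lemma feFunctional_apply (hΩ : IsOpen Ω) {r : E M → ℝ} (hr : r ∈ feSpace 𝒯 ℝ)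
    (f : Lp ℝ ∞ (volume.restrict Ω : Measure (E M))) :
    feFunctional 𝒯 r f = ∫ x in Ω, r x * f x := by
  have h1 : ∫ x in Ω, r x * f x = ∫ x in Ω, ∑ a ∈ 𝒯.nodeFinset, r a * (hat 𝒯 a x * f x) :=
    setIntegral_congr_fun hΩ.measurableSet fun x hx => by
      show r x * f x = _
      rw [eqOn_feInterp hr (fun _ _ => rfl) (subset_closure hx), feInterp, Finset.sum_mul]
      refine Finset.sum_congr rfl fun a _ => ?_
      rw [smul_eq_mul]
      ring
  rw [h1, integral_finsetSum 𝒯.nodeFinset fun a _ =>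
    (integrable_mul_Linf (integrableOn_hat a) f).const_mul (r a)]
  simp only [feFunctional, sum_apply, smul_apply, pairing_apply, integral_const_mul, smul_eq_mul]

/-- Duality: since `q t` is a finite element function, a test function `f` may be replaced by its
`L²(Ω)` projection, which is bounded by `f` in the maximum norm. -/
lemma exists_norm_feFunctional_le (M : ℕ) {ρ : ℝ} (hρ : 0 < ρ) :
    ∃ C : ℝ, 0 ≤ C ∧ ∀ (Ω : Set (E M)) (𝒯 : Triangulation Ω) (h γ α : ℝ)
      (u0h : E M → E M) (u : ℝ → E M → E M) (q : ℝ → E M → ℝ),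
      HasLipschitzBoundary Ω → IsOpen Ω → 𝒯.IsRegular ρ h → 0 < γ →
      IsFEMSolution 𝒯 γ α u0h u q → ∀ t : ℝ, 0 ≤ t →
      ‖feFunctional 𝒯 (q t)‖ ≤ C * gradNorm Ω (fePartial u0h) ^ 2 := by
  obtain ⟨C₁, hC₁, hproj⟩ := exists_projection_bound M hρ
  set C₂ : ℝ := (M + 1) ^ 2 * (M / ρ ^ 2) with hC₂def
  have hC₂ : 0 ≤ C₂ := by positivity
  refine ⟨C₂ * C₁, by positivity, ?_⟩
  intro Ω 𝒯 h γ α u0h u q hlip hΩ hreg hγ hsol t ht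
  refine ContinuousLinearMap.opNorm_le_bound _ (by positivity) fun f => ?_
  have hqmem := hsol.smooth_q.1 t ht
  rw [feFunctional_apply hΩ hqmem]
  obtain ⟨p, hp, hpf⟩ := exists_projection hlip hΩ hreg hρ f fun r hr => by
    have h1 : IntegrableOn r Ω :=
      (hr.1.integrableOn_compact 𝒯.isCompact_closure).mono_set subset_closure
    exact (integrable_mul_Linf h1 f).congr (Eventually.of_forall fun x => mul_comm _ _)
  have hpB : ∀ a ∈ 𝒯.nodes, |p a| ≤ C₁ * ‖f‖ :=
    hproj Ω 𝒯 h hlip hΩ hreg f ‖f‖ (ae_abs_le_norm f) p hp hpf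
  have heq : ∫ x in Ω, q t x * f x = ∫ x in Ω, q t x * p x := by
    simp only [mul_comm (q t _)]
    exact (hpf (q t) hqmem).symm
  rw [heq, Real.norm_eq_abs]
  calc |∫ x in Ω, q t x * p x| ≤ C₂ * (C₁ * ‖f‖) * gradInner Ω (u t) (u t) :=
        hsol.abs_integral_mul_le hγ hlip hΩ hreg hρ ht hp hpB
    _ ≤ C₂ * (C₁ * ‖f‖) * gradNorm Ω (fePartial u0h) ^ 2 := by
        gcongr
        exact hsol.gradInner_le_sq hγ hlip hΩ hreg hρ ht
    _ = C₂ * C₁ * gradNorm Ω (fePartial u0h) ^ 2 * ‖f‖ := by ring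

lemma continuousOn_feFunctional {q : ℝ → E M → ℝ} (hq : IsSmoothInTime 𝒯 q) :
    ContinuousOn (fun t => feFunctional 𝒯 (q t)) (Ici 0) :=
  continuousOn_finsetSum _ fun a ha => ContinuousOn.smul
    (hq.2 a (Triangulation.mem_closure_of_mem_nodes
      (Triangulation.mem_nodeFinset.1 ha))).continuousOn continuousOn_const

end Functional

/-- A bounded continuous family of functionals on `X`, restricted to a space `Y` along a map of
norm at most one, has an `L²(0, T)` norm of at most `√T` times its bound. -/
lemma memLp_comp_and_eLpNorm_le {X Y : Type*} [NormedAddCommGroup X] [NormedSpace ℝ X]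
    [NormedAddCommGroup Y] [NormedSpace ℝ Y] (L : Y →L[ℝ] X) (hL : ∀ y, ‖L y‖ ≤ ‖y‖)
    {f : ℝ → StrongDual ℝ X} (hf : ContinuousOn f (Ici 0)) {T B : ℝ} (hT : 0 < T) (hB : 0 ≤ B)
    (hfB : ∀ t : ℝ, 0 ≤ t → ‖f t‖ ≤ B) :
    MemLp (fun t => (f t).comp L) 2 (volume.restrict (Ioo 0 T)) ∧
      eLpNorm (fun t => (f t).comp L) 2 (volume.restrict (Ioo 0 T))
        ≤ ENNReal.ofReal (Real.sqrt T * B) := by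
  have hnorm : ∀ t ∈ Ioo 0 T, ‖(f t).comp L‖ ≤ B := fun t ht =>
    ContinuousLinearMap.opNorm_le_bound _ hB fun y => ((f t).le_opNorm (L y)).trans
      (mul_le_mul (hfB t ht.1.le) (hL y) (norm_nonneg _) hB)
  have hnorm_ae : ∀ᵐ t ∂(volume.restrict (Ioo 0 T)), ‖(f t).comp L‖ ≤ B :=
    (ae_restrict_iff' measurableSet_Ioo).2 (Eventually.of_forall hnorm)
  have hmeas : AEStronglyMeasurable (fun t => (f t).comp L) (volume.restrict (Ioo 0 T)) :=
    ContinuousOn.aestronglyMeasurable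
      ((hf.mono fun t ht => ht.1.le).clm_comp continuousOn_const) measurableSet_Ioo
  refine ⟨MemLp.of_bound hmeas _ hnorm_ae, (eLpNorm_le_of_ae_bound hnorm_ae).trans ?_⟩
  have hvol : (volume.restrict (Ioo 0 T)) univ ^ (2 : ℝ≥0∞).toReal⁻¹
      = ENNReal.ofReal (Real.sqrt T) := by
    rw [Measure.restrict_apply_univ, Real.volume_Ioo, sub_zero,
      ENNReal.ofReal_rpow_of_pos hT, Real.sqrt_eq_rpow]
    norm_num
  rw [hvol, ← ENNReal.ofReal_mul (Real.sqrt_nonneg _)]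

end HarmonicFEM

theorem mainTheorem3 {M : ℕ} (hM : M = 2 ∨ M = 3)
    (Ω : Set (E M)) (hΩ_open : IsOpen Ω) (hΩ_conn : IsConnected Ω)
    (hΩ_bdd : Bornology.IsBounded Ω) (hΩ_lip : HasLipschitzBoundary Ω)
    (γ α : ℝ) (hγ : 0 < γ) (hα : 0 ≤ α) (hMα : M = 2 → α = 0)
    {ι : Type*} (𝒯 : ι → Triangulation Ω)
    (hshape : ShapeRegular 𝒯) (hquasi : QuasiUniform 𝒯)
    (T : ℝ) (hT : 0 < T) :
    ∃ C : ℝ, 0 < C ∧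
      ∀ (i : ι) (u0 : E M → E M) (Du0 : Fin M → E M → E M) (u0h : E M → E M)
        (u : ℝ → E M → E M) (q : ℝ → E M → ℝ),
        IsInitialData (𝒯 i) u0 Du0 u0h →
        IsFEMSolution (𝒯 i) γ α u0h u q →
        ∃ Q : ℝ → StrongDual ℝ (H1Linf Ω),
          (∀ t ∈ Ioo 0 T, ∀ φ : H1Linf Ω,
            Q t φ = ∫ x in Ω, q t x * (φ : WithLp 1 (Lp ℝ ∞ (volume.restrict Ω) ×
              Lp (E M) 2 (volume.restrict Ω))).fst x) ∧
          MemLp Q 2 (volume.restrict (Ioo 0 T)) ∧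
          eLpNorm Q 2 (volume.restrict (Ioo 0 T)) ≤
            ENNReal.ofReal (C * (1 + gradNorm Ω Du0) * gradNorm Ω Du0) := by
  refine (exists_forall_isRegular (show 0 < M by omega) 𝒯 hshape hquasi).elim fun ρ hρ => ?_
  refine (exists_norm_feFunctional_le M hρ.1).elim fun C hC => ?_
  have hsq : 0 < Real.sqrt T * C + 1 :=
    add_pos_of_nonneg_of_pos (mul_nonneg (Real.sqrt_nonneg _) hC.1) one_pos
  -- the summand `1` only makes the constant positive
  refine ⟨Real.sqrt T * C + 1, hsq, ?_⟩
  intro i u0 Du0 u0h u q hdata hsol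
  have hD : 0 ≤ gradNorm Ω Du0 := Real.sqrt_nonneg _
  have hB : ∀ t : ℝ, 0 ≤ t → ‖feFunctional (𝒯 i) (q t)‖ ≤ C * gradNorm Ω Du0 ^ 2 := fun t ht =>
    (hρ.2 i).elim fun h hreg =>
      (hC.2 Ω (𝒯 i) h γ α u0h u q hΩ_lip hΩ_open hreg hγ hsol t ht).trans
        (mul_le_mul_of_nonneg_left (pow_le_pow_left₀ (Real.sqrt_nonneg _) hdata.grad_le 2) hC.1)
  have hmem := memLp_comp_and_eLpNorm_le (toLinf Ω) norm_toLinf_le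
    (continuousOn_feFunctional hsol.smooth_q) hT (mul_nonneg hC.1 (sq_nonneg _)) hB
  refine ⟨fun t => (feFunctional (𝒯 i) (q t)).comp (toLinf Ω), fun t ht φ => ?_, hmem.1,
    hmem.2.trans (ENNReal.ofReal_le_ofReal ?_)⟩
  · exact feFunctional_apply hΩ_open (hsol.smooth_q.1 t ht.1.le) (toLinf Ω φ)
  · nlinarith [mul_nonneg (mul_nonneg (Real.sqrt_nonneg T) hC.1) hD,
      sq_nonneg (gradNorm Ω Du0)]
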